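/- Let $d\ge 0$ be an integer, $\mathbb T=\{z\in\mathbb C:|z|=1\}$ and $\mathbb D=\{z\in\mathbb C:|z|<1\}$. Let $\mu$ be a matrix measure on $\mathbb T$, i.e. a countably additive function on the Borel subsets of $\mathbb T$ whose values are positive semidefinite complex $d\times d$ matrices, normalized by $\mu(\mathbb T)=\mathbf 1$. Let $\operatorname{supp}\mu$ be its support (the set of points of $\mathbb T$ all of whose open neighbourhoods in $\mathbb T$ have nonzero measure) and $(\operatorname{supp}\mu)'$ the set of limit points of $\operatorname{supp}\mu$. An isolated mass point of $\mu$ is a point $\lambda\in\mathbb T$ with $\mu(\{\lambda\})\neq 0$ which is an isolated point of $\operatorname{supp}\mu$. Let $f$ be the matrix Schur function of $\mu$, i.e. the analytic function on $\mathbb D$ given by $$f(z)=z^{-1}\,(F(z)-\mathbf 1)\,(F(z)+\mathbf 1)^{-1},\qquad F(z)=\int_{\mathbb T}\frac{t+z}{t-z}\,d\mu(t),$$ with the removable singularity at $z=0$ removed. An arc of $\mathbb T$ means a connected subset of $\mathbb T$ with more than one point. We say that $f$ has an analytic continuation through a set $\Gamma\subset\mathbb T$ if there are an open set $U\subset\mathbb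 C$ containing $\mathbb D\cup\Gamma$ and an analytic matrix valued function on $U$ which coincides with $f$ on $\mathbb D$. Then: (i) $\mathbb T\setminus(\operatorname{supp}\mu)'$ is the union of all the arcs $\Gamma$ of $\mathbb T$ through which $f$ has an analytic continuation which takes unitary values on $\Gamma$. Moreover, $f$ has a single analytic continuation through the whole set $\mathbb T\setminus(\operatorname{supp}\mu)'$ with unitary values on this set. (ii) Denote again by $f$ any analytic continuation of $f$ through $\mathbb T\setminus(\operatorname{supp}\mu)'$. A point $\lambda\in\mathbb T$ is an isolated mass point of $\mu$ if and only if $\lambda\in\mathbb T\setminus(\operatorname{supp}\mu)'$ and $\det(\mathbf 1-\lambda f(\lambda))=0$. For every isolated mass point $\lambda$ of $\mu$, $$\operatorname{range}\mu(\{\lambda\})=\ker(\mathbf 1-\lambda f(\lambda)).$$ -/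

import Mathlib

noncomputable section

namespace MatrixSchur

open MeasureTheory Set Filter Topology
open scoped ComplexOrder

/-- The unit circle carries its Borel sigma-algebra. -/
instance instMeasurableSpaceCircle : MeasurableSpace Circle := borel Circle

instance instBorelSpaceCircle : BorelSpace Circle := ⟨rfl⟩

variable {n : Type*} [Fintype n] [DecidableEq n]

/-- A matrix measure on the unit circle: a countably additive function on the Borel subsets of the
circle whose values are positive semidefinite complex matrices. -/
def IsMatrixMeasure (μ : VectorMeasure Circle (Matrix n n ℂ)) : Prop :=
  ∀ E : Set Circle, MeasurableSet E → (μ E).PosSemidef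

/-- The support of `μ`: the points all of whose open neighbourhoods have nonzero measure. -/
def supp (μ : VectorMeasure Circle (Matrix n n ℂ)) : Set Circle :=
  {t | ∀ V : Set Circle, IsOpen V → t ∈ V → μ V ≠ 0}

/-- `t` is a mass point of `μ` which is isolated in the support of `μ`. -/
def IsIsolatedMassPoint (μ : VectorMeasure Circle (Matrix n n ℂ)) (t : Circle) : Prop :=
  μ {t} ≠ 0 ∧ ∃ V : Set Circle, IsOpen V ∧ V ∩ supp μ = {t}

/-- The complex measure given by the `(i, j)` entry of `μ`. -/
def entry (μ : VectorMeasure Circle (Matrix n n ℂ)) (i j : n) : ComplexMeasure Circle :=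
  μ.mapRange (Matrix.entryAddMonoidHom ℂ i j) (continuous_id.matrix_elem i j)

/-- The Carathéodory function `F(z) = ∫ (t + z) / (t - z) dμ(t)`, integrated entrywise. -/
def caratheodory (μ : VectorMeasure Circle (Matrix n n ℂ)) (z : ℂ) : Matrix n n ℂ :=
  Matrix.of fun i j =>
    (entry μ i j).integral (fun t : Circle => ((t : ℂ) + z) / ((t : ℂ) - z))
      (ContinuousLinearMap.mul ℝ ℂ)

/-- The Schur function `f(z) = z⁻¹ (F(z) - 1) (F(z) + 1)⁻¹` of `μ` on the unit disk, where the
singularity at `z = 0` is removed, i.e. `f(0) = lim_{z → 0} f(z)`. Only its values on the open unit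
disk are meaningful. -/
def schur (μ : VectorMeasure Circle (Matrix n n ℂ)) : ℂ → Matrix n n ℂ :=
  let h : ℂ → Matrix n n ℂ := fun z =>
    z⁻¹ • ((caratheodory μ z - 1) * (caratheodory μ z + 1)⁻¹)
  Function.update h 0 (limUnder (𝓝[≠] 0) h)

/-- `g` is an analytic continuation of `f : 𝔻 → Matrix n n ℂ` to the open set `U ⊇ 𝔻`
(analyticity of a matrix valued function being analyticity of its entries). -/
def IsAnalyticContinuation (f : ℂ → Matrix n n ℂ) (U : Set ℂ) (g : ℂ → Matrix n n ℂ) : Prop :=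
  IsOpen U ∧ Metric.ball (0 : ℂ) 1 ⊆ U ∧
    (∀ i j : n, AnalyticOnNhd ℂ (fun z => g z i j) U) ∧
    EqOn g f (Metric.ball (0 : ℂ) 1)

/-- `f : 𝔻 → Matrix n n ℂ` has an analytic continuation through the subset `Γ` of the unit circle
which takes unitary values on `Γ`. -/
def HasUnitaryContinuation (f : ℂ → Matrix n n ℂ) (Γ : Set Circle) : Prop :=
  ∃ (U : Set ℂ) (g : ℂ → Matrix n n ℂ), IsAnalyticContinuation f U g ∧
    ∀ t ∈ Γ, (t : ℂ) ∈ U ∧ g (t : ℂ) ∈ Matrix.unitaryGroup n ℂ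

/-- The nondegenerate arcs (open, half-open or closed, possibly the whole circle) of the unit
circle, i.e. its connected subsets with more than one point. -/
def IsArc (Γ : Set Circle) : Prop :=
  IsConnected Γ ∧ Γ.Nontrivial

end MatrixSchur

end

noncomputable section

namespace MatrixSchur

open MeasureTheory Set Filter Topology
open scoped ComplexOrder

/-! ### Quadratic forms, polarization and scalar measures -/

variable {n : Type*} [Fintype n] [DecidableEq n]

/-! For every vector `v`, `v* μ v` is a finite positive measure, and polarization recovers the
entries of `μ` and `F` from four such measures. The analysis on the circle is thus scalar: `v* F(z)
v` is a Herglotz transform, whose real part is a Poisson integral. The Cayley transform carries this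
over to `W(z) = z f(z)`: one has `F (1 - W) = (1 - W) F = 1 + W` in the disk, `W` is a contraction
because `F` has nonnegative real part, and `W` is unitary wherever `F` is skew-hermitian.

At a point of the circle that is not a limit point of the support, `F` is meromorphic, so `f` is
meromorphic too; being bounded along a radius, `f` has a removable singularity there. At the
neighbouring points of the circle `F` is skew-hermitian, and continuity makes the value of `f`
unitary (`isRemovable_preSchur_of_notMem_derivedSet`, `fillIn_preSchur_mem_unitaryGroup`).

Conversely, let `f` continue with unitary values through an arc. Since `1 - W` is invertible in the
disk, the zeros of `det (1 - W)` near the arc are isolated. Away from them `F` continues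
analytically and is skew-hermitian on the circle, so the Poisson integrals are `O(1 - |z|)`; a
covering argument then shows that there is no mass (`exists_isOpen_measure_eq_zero`,
`notMem_supp_of_unitary`). Hence the support does not accumulate on the arc.

Masses are radial limits: `(1 - r) / 2 * F(r t)` tends to `μ {t}`. Inserted into the Cayley
relations, this identifies the range of `μ {t}` with the kernel of `1 - t f(t)` at every point of
continuation (`range_eq_ker`). -/

/-- The quadratic form `v ↦ v* A v` of a matrix, as an additive map in `A`. -/
def quadForm (v : n → ℂ) : Matrix n n ℂ →+ ℂ where
  toFun A := star v ⬝ᵥ A.mulVec v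
  map_zero' := by simp
  map_add' A B := by simp [Matrix.add_mulVec]

omit [DecidableEq n] in
lemma quadForm_apply (v : n → ℂ) (A : Matrix n n ℂ) :
    quadForm v A = star v ⬝ᵥ A.mulVec v := rfl

omit [DecidableEq n] in
lemma quadForm_eq_sum (v : n → ℂ) (A : Matrix n n ℂ) :
    quadForm v A = ∑ i, ∑ j, star (v i) * v j * A i j := by
  simp only [quadForm_apply, dotProduct, Matrix.mulVec, Finset.mul_sum, Pi.star_apply]
  exact Finset.sum_congr rfl fun i _ => Finset.sum_congr rfl fun j _ => by ring

omit [DecidableEq n] in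
lemma continuous_quadForm (v : n → ℂ) : Continuous (quadForm v) := by
  have : (quadForm v : Matrix n n ℂ → ℂ) = fun A => ∑ i, ∑ j, star (v i) * v j * A i j :=
    funext (quadForm_eq_sum v)
  rw [this]
  fun_prop

/-- The vectors `eᵢ + iᵏ eⱼ` of the polarization identity. -/
def polarVec (i j : n) (k : Fin 4) : n → ℂ :=
  Pi.single i 1 + (Complex.I ^ (k : ℕ)) • Pi.single j 1

lemma quadForm_polarVec (A : Matrix n n ℂ) (i j : n) (k : Fin 4) :
    quadForm (polarVec i j k) A =
      A i i + Complex.I ^ (k : ℕ) * A i j + star (Complex.I ^ (k : ℕ)) * A j i +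
        star (Complex.I ^ (k : ℕ)) * Complex.I ^ (k : ℕ) * A j j := by
  simp only [quadForm_apply, polarVec, star_add, star_smul, Matrix.mulVec_add, Matrix.mulVec_smul,
    dotProduct_add, add_dotProduct, smul_dotProduct, dotProduct_smul, Matrix.mulVec_single_one,
    Pi.star_single, star_one, single_one_dotProduct, Matrix.col_apply, smul_eq_mul]
  ring

lemma apply_eq_polarization (A : Matrix n n ℂ) (i j : n) :
    A i j = (1 / 4) *
      ∑ k : Fin 4, star (Complex.I ^ (k : ℕ)) * quadForm (polarVec i j k) A := by
  simp only [quadForm_polarVec, Fin.sum_univ_four]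
  have h3 : Complex.I ^ 3 = -Complex.I := by rw [pow_succ, Complex.I_sq]; ring
  simp [h3]
  ring_nf
  simp
  ring

omit [DecidableEq n] in
/-- `A + Aᴴ` is positive semidefinite as soon as the
quadratic form of `A` has nonnegative real part. -/
lemma posSemidef_add_conjTranspose {A : Matrix n n ℂ} (h : ∀ v, 0 ≤ (quadForm v A).re) :
    (A + A.conjTranspose).PosSemidef := by
  refine Matrix.PosSemidef.of_dotProduct_mulVec_nonneg (by
    simp [Matrix.IsHermitian, add_comm]) fun v => ?_
  have h1 : star v ⬝ᵥ A.conjTranspose.mulVec v = star (star v ⬝ᵥ A.mulVec v) := by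
    rw [Matrix.dotProduct_mulVec, ← Matrix.star_mulVec, Matrix.star_dotProduct]
  rw [Matrix.add_mulVec, dotProduct_add, h1]
  have := h v
  rw [quadForm_apply] at this
  rw [Complex.le_def]
  simp
  linarith

variable {μ : VectorMeasure Circle (Matrix n n ℂ)}

/-- The positive measure `E ↦ v* μ(E) v`. -/
def scalarMeasure (hμ : IsMatrixMeasure μ) (v : n → ℂ) : Measure Circle :=
  SignedMeasure.toMeasureOfZeroLE
    (μ.mapRange (Complex.reAddGroupHom.comp (quadForm v))
      (Complex.continuous_re.comp (continuous_quadForm v))) univ MeasurableSet.univ (by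
    refine (VectorMeasure.le_restrict_univ_iff_le _ _).2 fun E hE => ?_
    exact (Complex.le_def.1 ((hμ E hE).dotProduct_mulVec_nonneg v)).1)

instance (hμ : IsMatrixMeasure μ) (v : n → ℂ) : IsFiniteMeasure (scalarMeasure hμ v) := by
  unfold scalarMeasure
  infer_instance

omit [DecidableEq n] in
lemma scalarMeasure_real (hμ : IsMatrixMeasure μ) (v : n → ℂ) {E : Set Circle}
    (hE : MeasurableSet E) : ((scalarMeasure hμ v).real E : ℂ) = quadForm v (μ E) := by
  have h0 := Complex.le_def.1 ((hμ E hE).dotProduct_mulVec_nonneg v)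
  rw [scalarMeasure, SignedMeasure.toMeasureOfZeroLE_real_apply _ _ _ hE]
  apply Complex.ext
  · rw [univ_inter]
    rfl
  · exact h0.2

/-- Polarization bounds each entry of `μ E` by four positive masses. The resulting finite variation
makes bounded measurable functions integrable against the entries. -/
lemma variation_entry_le (hμ : IsMatrixMeasure μ) (i j : n) :
    (entry μ i j).variation ≤ ∑ k : Fin 4, scalarMeasure hμ (polarVec i j k) := by
  refine VectorMeasure.variation_le_of_forall_enorm_le fun E hE => ?_
  have h1 : ‖entry μ i j E‖ ≤ ∑ k : Fin 4, (scalarMeasure hμ (polarVec i j k)).real E := by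
    have : entry μ i j E = μ E i j := rfl
    rw [this, apply_eq_polarization (μ E) i j, norm_mul]
    have h2 : ‖∑ k : Fin 4, star (Complex.I ^ (k : ℕ)) * quadForm (polarVec i j k) (μ E)‖ ≤
        ∑ k : Fin 4, (scalarMeasure hμ (polarVec i j k)).real E := by
      refine (norm_sum_le _ _).trans (Finset.sum_le_sum fun k _ => ?_)
      rw [← scalarMeasure_real hμ _ hE]
      simp [abs_of_nonneg measureReal_nonneg]
    have h3 : 0 ≤ ∑ k : Fin 4, (scalarMeasure hμ (polarVec i j k)).real E := by positivity
    norm_num at *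
    linarith
  rw [← ofReal_norm, Measure.coe_finsetSum, Finset.sum_apply]
  refine (ENNReal.ofReal_le_ofReal h1).trans (le_of_eq ?_)
  rw [ENNReal.ofReal_sum_of_nonneg (by intros; positivity)]
  exact Finset.sum_congr rfl fun k _ => ofReal_measureReal

lemma isFiniteMeasure_variation_entry (hμ : IsMatrixMeasure μ) (i j : n) :
    IsFiniteMeasure (entry μ i j).variation :=
  isFiniteMeasure_of_le _ (variation_entry_le hμ i j)

/-- On indicators this is the defining property of `scalarMeasure`; linearity gives simple
functions, and dominated convergence on both sides gives bounded ones. -/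
lemma sum_integral_entry_of_bounded (hμ : IsMatrixMeasure μ) (v : n → ℂ) {f : Circle → ℂ}
    (hf : StronglyMeasurable f) {C : ℝ} (hC : ∀ s, ‖f s‖ ≤ C) :
    ∑ i, ∑ j, star (v i) * v j * (entry μ i j).integral f (ContinuousLinearMap.mul ℝ ℂ) =
      ∫ s, f s ∂(scalarMeasure hμ v) := by
  have hfin := isFiniteMeasure_variation_entry hμ
  have hC0 : 0 ≤ C := (norm_nonneg _).trans (hC 1)
  have hint : ∀ (i j : n) (g : SimpleFunc Circle ℂ), (entry μ i j).Integrable g := fun i j g =>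
    SimpleFunc.integrable_of_isFiniteMeasure g
  have simple : ∀ g : SimpleFunc Circle ℂ,
      ∑ i, ∑ j, star (v i) * v j * (entry μ i j).integral g (ContinuousLinearMap.mul ℝ ℂ) =
        ∫ s, g s ∂(scalarMeasure hμ v) := by
    intro g
    induction g using SimpleFunc.induction with
    | const c hs =>
      rename_i s
      classical
      have h1 : ∀ i j : n, (entry μ i j).integral (s.indicator fun _ => c)
          (ContinuousLinearMap.mul ℝ ℂ) = c * μ s i j := fun i j => by
        rw [VectorMeasure.integral_eq_setToFun]
        rw [setToFun_indicator_const _ hs (measure_ne_top _ _)]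
        rfl
      have h2 : ⇑(SimpleFunc.piecewise s hs (SimpleFunc.const Circle c)
          (SimpleFunc.const Circle 0)) = s.indicator fun _ => c :=
        Set.piecewise_eq_indicator
      rw [h2, integral_indicator_const _ hs, Complex.real_smul, scalarMeasure_real hμ v hs,
        quadForm_eq_sum, Finset.sum_mul]
      simp only [h1, Finset.sum_mul]
      exact Finset.sum_congr rfl fun i _ => Finset.sum_congr rfl fun j _ => by ring
    | add _ h1 h2 =>
      rename_i g1 g2 _
      simp only [SimpleFunc.coe_add]
      simp only [VectorMeasure.integral_add (hint _ _ g1) (hint _ _ g2), mul_add,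
        Finset.sum_add_distrib, h1, h2, Pi.add_apply]
      exact (integral_add (SimpleFunc.integrable_of_isFiniteMeasure g1)
        (SimpleFunc.integrable_of_isFiniteMeasure g2)).symm
  refine tendsto_nhds_unique (f := fun m => ∫ s, hf.approxBounded C m s ∂(scalarMeasure hμ v))
    (l := atTop) ?_ ?_
  · simp only [← simple]
    refine tendsto_finsetSum _ fun i _ => tendsto_finsetSum _ fun j _ => Tendsto.const_mul _ ?_
    exact VectorMeasure.tendsto_integral_filter_of_norm_le_const
      (.of_forall fun m => (SimpleFunc.aestronglyMeasurable _))
      ⟨C, .of_forall fun m => .of_forall fun s => hf.norm_approxBounded_le hC0 m s⟩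
      (.of_forall fun s => hf.tendsto_approxBounded_of_norm_le (hC s))
  · exact tendsto_integral_filter_of_norm_le_const
      (.of_forall fun m => (SimpleFunc.aestronglyMeasurable _))
      ⟨C, .of_forall fun m => .of_forall fun s => hf.norm_approxBounded_le hC0 m s⟩
      (.of_forall fun s => hf.tendsto_approxBounded_of_norm_le (hC s))

/-! ### The Herglotz transform of a scalar measure -/

/-- The Herglotz kernel. -/
def herglotz (z : ℂ) (s : Circle) : ℂ := ((s : ℂ) + z) / ((s : ℂ) - z)

lemma measurable_herglotz (z : ℂ) : Measurable (herglotz z) := by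
  unfold herglotz
  have : Measurable (fun s : Circle => (s : ℂ)) :=
    (by fun_prop : Continuous fun s : Circle => (s : ℂ)).measurable
  exact (this.add_const z).div (this.sub_const z)

lemma norm_herglotz_le {z : ℂ} {s : Circle} {δ : ℝ} (hδ : 0 < δ) (h : δ ≤ dist (s : ℂ) z) :
    ‖herglotz z s‖ ≤ (1 + ‖z‖) / δ := by
  rw [herglotz, norm_div]
  rw [dist_eq_norm] at h
  gcongr
  exact (norm_add_le _ _).trans (by rw [Circle.norm_coe])

/-- The points of the circle at distance less than `δ` from `z`. -/
def circleBall (z : ℂ) (δ : ℝ) : Set Circle := {s | dist (s : ℂ) z < δ}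

lemma isOpen_circleBall (z : ℂ) (δ : ℝ) : IsOpen (circleBall z δ) :=
  isOpen_lt (by fun_prop) continuous_const

lemma quadForm_caratheodory (hμ : IsMatrixMeasure μ) (v : n → ℂ) {z : ℂ} {δ : ℝ} (hδ : 0 < δ)
    (h : ∀ v, scalarMeasure hμ v (circleBall z δ) = 0) :
    quadForm v (caratheodory μ z) = ∫ s, herglotz z s ∂(scalarMeasure hμ v) := by
  have hB : MeasurableSet (circleBall z δ) := (isOpen_circleBall z δ).measurableSet
  -- For `z` on the circle the kernel is unbounded; cutting it off on the null ball makes it bounded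
  -- and changes no integral.
  set f : Circle → ℂ := (circleBall z δ)ᶜ.indicator (herglotz z) with hf
  have hfm : StronglyMeasurable f :=
    ((measurable_herglotz z).indicator hB.compl).stronglyMeasurable
  have key : ∀ ρ : Measure Circle, ρ (circleBall z δ) = 0 → herglotz z =ᵐ[ρ] f := fun ρ hρ => by
    have : ∀ᵐ s ∂ρ, s ∉ circleBall z δ := measure_eq_zero_iff_ae_notMem.1 hρ
    filter_upwards [this] with s hs
    simp [hf, hs]
  have hent : ∀ i j : n, caratheodory μ z i j =
      (entry μ i j).integral f (ContinuousLinearMap.mul ℝ ℂ) := fun i j => by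
    refine VectorMeasure.integral_congr_ae (key _ ?_)
    refine le_antisymm ((variation_entry_le hμ i j _).trans ?_) zero_le
    simp [h]
  rw [integral_congr_ae (key _ (h v)), quadForm_eq_sum]
  simp only [hent]
  refine sum_integral_entry_of_bounded hμ v hfm (C := (1 + ‖z‖) / δ) fun s => ?_
  by_cases hs : s ∈ circleBall z δ
  · rw [hf, Set.indicator_of_notMem (by simpa using hs), norm_zero]
    positivity
  · rw [hf, Set.indicator_of_mem hs]
    exact norm_herglotz_le hδ (not_lt.1 hs)

/-- The Herglotz transform of a measure on the circle. -/
def herglotzTransform (ν : Measure Circle) (z : ℂ) : ℂ := ∫ s, herglotz z s ∂ν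

lemma integrable_herglotz (ν : Measure Circle) [IsFiniteMeasure ν] {z : ℂ} {δ : ℝ} (hδ : 0 < δ)
    (h : ν (circleBall z δ) = 0) : Integrable (herglotz z) ν := by
  refine Integrable.of_bound (measurable_herglotz z).aestronglyMeasurable ((1 + ‖z‖) / δ) ?_
  filter_upwards [measure_eq_zero_iff_ae_notMem.1 h] with s hs
  exact norm_herglotz_le hδ (not_lt.1 hs)

lemma circleBall_eq_empty {z : ℂ} : circleBall z (1 - ‖z‖) = ∅ := by
  refine eq_empty_of_forall_notMem fun s (hs : dist (s : ℂ) z < _) => ?_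
  have h1 : ‖(s : ℂ)‖ - ‖z‖ ≤ dist (s : ℂ) z := by
    rw [dist_eq_norm]
    exact norm_sub_norm_le _ _
  rw [Circle.norm_coe] at h1
  linarith

lemma re_herglotz (z : ℂ) (s : Circle) :
    (herglotz z s).re = (1 - ‖z‖ ^ 2) / ‖(s : ℂ) - z‖ ^ 2 := by
  have hs : Complex.normSq (s : ℂ) = 1 := Circle.normSq_coe s
  rw [herglotz, Complex.div_re, ← add_div, ← Complex.normSq_eq_norm_sq, ← Complex.normSq_eq_norm_sq]
  congr 1
  simp only [Complex.normSq_apply] at *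
  simp only [Complex.add_re, Complex.sub_re, Complex.add_im, Complex.sub_im]
  linarith

lemma re_herglotzTransform (ν : Measure Circle) [IsFiniteMeasure ν] {z : ℂ} {δ : ℝ} (hδ : 0 < δ)
    (h : ν (circleBall z δ) = 0) :
    (herglotzTransform ν z).re = ∫ s, (1 - ‖z‖ ^ 2) / ‖(s : ℂ) - z‖ ^ 2 ∂ν := by
  simp_rw [← re_herglotz]
  exact (integral_re (integrable_herglotz ν hδ h)).symm

lemma re_herglotzTransform_nonneg (ν : Measure Circle) [IsFiniteMeasure ν] {z : ℂ} (hz : ‖z‖ < 1) :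
    0 ≤ (herglotzTransform ν z).re := by
  rw [re_herglotzTransform ν (sub_pos.2 hz) (by simp [circleBall_eq_empty])]
  refine integral_nonneg fun s => ?_
  have : ‖z‖ ^ 2 ≤ 1 := pow_le_one₀ (norm_nonneg _) hz.le
  exact div_nonneg (by linarith) (by positivity)

lemma re_herglotzTransform_eq_zero (ν : Measure Circle) [IsFiniteMeasure ν] {z : ℂ} {δ : ℝ}
    (hδ : 0 < δ) (h : ν (circleBall z δ) = 0) (hz : ‖z‖ = 1) :
    (herglotzTransform ν z).re = 0 := by
  rw [re_herglotzTransform ν hδ h]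
  simp [hz]

lemma herglotzTransform_zero (ν : Measure Circle) :
    herglotzTransform ν 0 = ν.real univ := by
  simp [herglotzTransform, herglotz]

lemma analyticAt_herglotzTransform (ν : Measure Circle) [IsFiniteMeasure ν] {z₀ : ℂ} {δ : ℝ}
    (hδ : 0 < δ) (h : ν (circleBall z₀ δ) = 0) : AnalyticAt ℂ (herglotzTransform ν) z₀ := by
  have hnull : ∀ z ∈ Metric.ball z₀ (δ / 2), ν (circleBall z (δ / 2)) = 0 := fun z hz => by
    refine measure_mono_null (fun s (hs : dist (s : ℂ) z < δ / 2) => ?_) h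
    have := dist_triangle (s : ℂ) z z₀
    rw [Metric.mem_ball] at hz
    change dist (s : ℂ) z₀ < δ
    linarith
  have hd : DifferentiableOn ℂ (herglotzTransform ν) (Metric.ball z₀ (δ / 2)) := fun z hz => by
    refine DifferentiableAt.differentiableWithinAt ?_
    have hmeas : Measurable (fun s : Circle => (s : ℂ)) :=
      (by fun_prop : Continuous fun s : Circle => (s : ℂ)).measurable
    -- For `w` within `δ / 2` of `z₀`, almost every `s` has distance at least `δ / 2` from `w`; this
    -- yields the constant bound on the derivative.
    refine (hasDerivAt_integral_of_dominated_loc_of_deriv_le (μ := ν)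
      (F := herglotz) (F' := fun w s => 2 * (s : ℂ) / ((s : ℂ) - w) ^ 2)
      (bound := fun _ => 2 / (δ / 2) ^ 2) (Metric.isOpen_ball.mem_nhds hz)
      (.of_forall fun w => (measurable_herglotz w).aestronglyMeasurable)
      (integrable_herglotz ν (half_pos hδ) (hnull z hz)) ?_ ?_ (integrable_const _) ?_).2.differentiableAt
    · exact ((hmeas.const_mul 2).div ((hmeas.sub_const z).pow_const 2)).aestronglyMeasurable
    · filter_upwards [measure_eq_zero_iff_ae_notMem.1 h] with s hs w hw
      have h1 : δ / 2 ≤ ‖(s : ℂ) - w‖ := by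
        rw [← dist_eq_norm]
        have h2 : δ ≤ dist (s : ℂ) z₀ := not_lt.1 hs
        have := dist_triangle (s : ℂ) w z₀
        rw [Metric.mem_ball] at hw
        linarith
      rw [norm_div, norm_mul, norm_pow, Circle.norm_coe]
      norm_num only [Complex.norm_ofNat, mul_one]
      gcongr
    · filter_upwards [measure_eq_zero_iff_ae_notMem.1 h] with s hs w hw
      have h1 : (s : ℂ) - w ≠ 0 := fun h0 => by
        have h2 : δ ≤ dist (s : ℂ) z₀ := not_lt.1 hs
        rw [sub_eq_zero.1 h0] at h2
        rw [Metric.mem_ball] at hw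
        linarith
      have := ((hasDerivAt_id w).const_add (s : ℂ)).div ((hasDerivAt_id w).const_sub (s : ℂ)) h1
      convert! this using 1
      simp only [id]
      ring
  exact hd.analyticAt (Metric.ball_mem_nhds _ (half_pos hδ))

/-- Without its atom at `t` the measure has no mass near `t`, so its transform is analytic there;
the atom contributes a multiple of `(t + z) / (t - z)`. -/
lemma meromorphicAt_herglotzTransform (ν : Measure Circle) [IsFiniteMeasure ν] {t : Circle} {δ : ℝ}
    (hδ : 0 < δ) (h : ν (circleBall t δ \ {t}) = 0) : MeromorphicAt (herglotzTransform ν) t := by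
  have h1 : (ν.restrict {t}ᶜ) (circleBall t δ) = 0 := by
    rw [Measure.restrict_apply (isOpen_circleBall _ _).measurableSet]
    exact h
  have h2 := (analyticAt_herglotzTransform _ hδ h1).meromorphicAt
  have h3 : MeromorphicAt (fun z : ℂ => (ν.real {t} : ℂ) * (((t : ℂ) + z) / ((t : ℂ) - z))) t := by
    fun_prop
  refine (h3.add h2).congr ?_
  have h4 : ∀ᶠ z : ℂ in 𝓝[≠] (t : ℂ), z ∈ Metric.ball (t : ℂ) (δ / 2) :=
    nhdsWithin_le_nhds (Metric.ball_mem_nhds _ (half_pos hδ))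
  filter_upwards [h4, self_mem_nhdsWithin] with z hz hzt
  have hpos : 0 < dist (t : ℂ) z := dist_pos.2 (Ne.symm hzt)
  -- The first radius keeps the ball off `t`, the second keeps it within distance `δ` of `t`.
  have hnull : ν (circleBall z (min (dist (t : ℂ) z) (δ / 2))) = 0 := by
    refine measure_mono_null (t := circleBall t δ \ {t}) ?_ h
    rintro s (hs : dist (s : ℂ) z < _)
    refine ⟨?_, ?_⟩
    · have := dist_triangle (s : ℂ) z t
      rw [Metric.mem_ball] at hz
      have := hs.trans_le (min_le_right _ _)
      change dist (s : ℂ) t < δ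
      linarith
    · rintro rfl
      exact (hs.trans_le (min_le_left _ _)).false
  have hint := integrable_herglotz ν (lt_min hpos (half_pos hδ)) hnull
  rw [herglotzTransform, ← integral_add_compl (measurableSet_singleton t) hint,
    Measure.restrict_singleton, integral_smul_measure, integral_dirac]
  simp [herglotzTransform, herglotz, Measure.real]

/-- The kernel times `(1 - r) / 2` is bounded by `1` and tends to the indicator of `{t}`: at `s = t`
it equals `(1 + r) / 2`, elsewhere it tends to `0`. -/
lemma tendsto_radial_herglotzTransform (ν : Measure Circle) [IsFiniteMeasure ν] (t : Circle) :
    Tendsto (fun r : ℝ => ((1 - r) / 2 : ℂ) * herglotzTransform ν (r * t)) (𝓝[<] 1)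
      (𝓝 (ν.real {t})) := by
  have h1 : (ν.real {t} : ℂ) = ∫ s, ({t} : Set Circle).indicator (fun _ => (1 : ℂ)) s ∂ν := by
    rw [integral_indicator_const _ (measurableSet_singleton t)]
    simp
  rw [h1]
  simp only [herglotzTransform, ← integral_const_mul]
  have hr : ∀ᶠ r : ℝ in 𝓝[<] 1, r ∈ Ioo (0 : ℝ) 1 := Ioo_mem_nhdsLT one_pos
  refine tendsto_integral_filter_of_norm_le_const
    (.of_forall fun r => ((measurable_herglotz _).const_mul _).aestronglyMeasurable)
    ⟨1, ?_⟩ (.of_forall fun s => ?_)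
  · filter_upwards [hr] with r hr
    refine .of_forall fun s => ?_
    have hz : ‖(r : ℂ) * t‖ = r := by
      rw [norm_mul, Circle.norm_coe, Complex.norm_real, Real.norm_of_nonneg hr.1.le, mul_one]
    have h2 : 1 - r ≤ dist (s : ℂ) (r * t) := by
      rw [dist_eq_norm]
      refine le_trans ?_ (norm_sub_norm_le _ _)
      rw [hz, Circle.norm_coe]
    have h3 := norm_herglotz_le (sub_pos.2 hr.2) h2
    rw [hz] at h3
    have h4 : ‖((1 - r) / 2 : ℂ)‖ = (1 - r) / 2 := by
      have : ((1 - r) / 2 : ℂ) = (((1 - r) / 2 : ℝ) : ℂ) := by push_cast; rfl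
      rw [this, Complex.norm_real, Real.norm_of_nonneg (by linarith [hr.2])]
    rw [norm_mul, h4]
    have h5 : 0 < 1 - r := sub_pos.2 hr.2
    calc _ ≤ (1 - r) / 2 * ((1 + r) / (1 - r)) := by gcongr
      _ = (1 + r) / 2 := by field_simp
      _ ≤ 1 := by linarith [hr.2]
  · by_cases hst : s = t
    · subst hst
      have h2 : Tendsto (fun r : ℝ => ((1 + r) / 2 : ℂ)) (𝓝[<] 1) (𝓝 1) := by
        have : Continuous fun r : ℝ => ((1 + r) / 2 : ℂ) := by fun_prop
        have h3 := (this.tendsto 1).mono_left (nhdsWithin_le_nhds (s := Iio 1))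
        norm_num at h3
        exact h3
      simp only [mem_singleton_iff, indicator_of_mem]
      refine h2.congr' ?_
      filter_upwards [hr] with r hr
      have h5 : (1 - r : ℂ) ≠ 0 := by
        rw [sub_ne_zero]
        exact_mod_cast hr.2.ne'
      have h6 : (s : ℂ) ≠ 0 := Circle.coe_ne_zero s
      rw [herglotz, show (s : ℂ) + r * s = (1 + r) * s by ring,
        show (s : ℂ) - r * s = (1 - r) * s by ring]
      field_simp
    · have h0 : (s : ℂ) - (1 : ℝ) * t ≠ 0 := by
        simpa [sub_eq_zero, Circle.coe_inj] using hst
      have : ContinuousAt (fun r : ℝ => ((1 - r) / 2 : ℂ) * herglotz (r * t) s) 1 := by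
        unfold herglotz
        fun_prop (disch := exact h0)
      have h3 := this.tendsto.mono_left (nhdsWithin_le_nhds (s := Iio 1))
      simpa [hst] using h3

/-! ### Vanishing of mass from decay of the Poisson integral -/

lemma dist_circle_mul_exp_le (s : Circle) (x y : ℝ) :
    dist ((s * Circle.exp x : Circle) : ℂ) (s * Circle.exp y : Circle) ≤ |x - y| := by
  have h : ((s * Circle.exp x : Circle) : ℂ) - (s * Circle.exp y : Circle) =
      (s * Circle.exp y : Circle) * (Complex.exp (Complex.I * (x - y : ℝ)) - 1) := by
    have h1 : s * Circle.exp x = s * Circle.exp y * Circle.exp (x - y) := by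
      rw [mul_assoc, ← Circle.exp_add]
      congr 2
      ring
    rw [h1, Circle.coe_mul, Circle.coe_exp (x - y), mul_comm Complex.I]
    ring
  rw [dist_eq_norm, h, norm_mul, Circle.norm_coe, one_mul]
  exact Real.norm_exp_I_mul_ofReal_sub_one_le

/-- At `z = (1 - d) s` the Poisson kernel is `d (2 - d) / |x - z|²`, and `|x - z| ≤ 2 d` on the
ball, so the kernel is at least `1 / (4 d)` there. -/
lemma measureReal_circleBall_le (ν : Measure Circle) [IsFiniteMeasure ν] (s : Circle) {d : ℝ}
    (hd : 0 < d) (hd1 : d < 1) :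
    ν.real (circleBall s d) ≤ 4 * d * (herglotzTransform ν ((1 - d : ℝ) * s)).re := by
  have hz : ‖((1 - d : ℝ) : ℂ) * s‖ = 1 - d := by
    rw [norm_mul, Circle.norm_coe, Complex.norm_real, Real.norm_of_nonneg (by linarith), mul_one]
  set z : ℂ := ((1 - d : ℝ) : ℂ) * s with hzdef
  have hzlt : ‖z‖ < 1 := by rw [hz]; linarith
  have hnull : ν (circleBall z (1 - ‖z‖)) = 0 := by simp [circleBall_eq_empty]
  have hint : Integrable (fun x : Circle => (1 - ‖z‖ ^ 2) / ‖(x : ℂ) - z‖ ^ 2) ν := by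
    have := (integrable_herglotz ν (sub_pos.2 hzlt) hnull).re
    simpa only [RCLike.re_eq_complex_re, re_herglotz] using this
  rw [re_herglotzTransform ν (sub_pos.2 hzlt) hnull]
  have hB := (isOpen_circleBall (s : ℂ) d).measurableSet
  have hind : Integrable ((circleBall (s : ℂ) d).indicator fun _ => 1 / (4 * d)) ν :=
    (integrable_const _).indicator hB
  have hle : ∫ x, (circleBall (s : ℂ) d).indicator (fun _ => 1 / (4 * d)) x ∂ν ≤
      ∫ x : Circle, (1 - ‖z‖ ^ 2) / ‖(x : ℂ) - z‖ ^ 2 ∂ν := by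
    refine integral_mono hind hint fun x => ?_
    have h0 : 0 ≤ 1 - ‖z‖ ^ 2 := by rw [hz]; nlinarith
    by_cases hx : x ∈ circleBall (s : ℂ) d
    swap
    · rw [indicator_of_notMem hx]
      positivity
    rw [indicator_of_mem hx]
    have h1 : ‖(x : ℂ) - z‖ ≤ 2 * d := by
      have h2 : dist (s : ℂ) z = d := by
        rw [dist_eq_norm, hzdef, show (s : ℂ) - (1 - d : ℝ) * s = (d : ℝ) * s by push_cast; ring,
          norm_mul, Circle.norm_coe, Complex.norm_real, Real.norm_of_nonneg hd.le, mul_one]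
      have h3 : dist (x : ℂ) s < d := hx
      have := dist_triangle (x : ℂ) s z
      rw [← dist_eq_norm]
      linarith
    have h2 : 0 < ‖(x : ℂ) - z‖ := by
      have := norm_sub_norm_le (x : ℂ) z
      rw [Circle.norm_coe, hz] at this
      linarith
    rw [div_le_div_iff₀ (by positivity) (by positivity), hz, one_mul]
    have h3 : 0 ≤ d ^ 2 * (1 - d) := mul_nonneg (sq_nonneg d) (by linarith)
    calc ‖(x : ℂ) - z‖ ^ 2 ≤ (2 * d) ^ 2 := by gcongr
      _ ≤ _ := by nlinarith
  rw [integral_indicator_const _ hB, smul_eq_mul] at hle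
  have h4 : ν.real (circleBall (s : ℂ) d) = 4 * d * (ν.real (circleBall s d) * (1 / (4 * d))) := by
    field_simp
  rw [h4]
  gcongr

/-- A measure whose Poisson integral vanishes to first order at an arc has no mass there. -/
lemma exists_isOpen_measure_eq_zero (ν : Measure Circle) [IsFiniteMeasure ν] (s₀ : Circle)
    {C δ : ℝ} (hδ : 0 < δ)
    (h : ∀ z : ℂ, ‖z‖ < 1 → dist z s₀ < δ → (herglotzTransform ν z).re ≤ C * (1 - ‖z‖)) :
    ∃ V : Set Circle, IsOpen V ∧ s₀ ∈ V ∧ ν V = 0 := by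
  -- The centres used below lie within `δ / 4` of `s₀`, and moving inwards by `d < δ / 2` stays in
  -- the region governed by `h`.
  set ε : ℝ := δ / 4 with hε
  have hε0 : 0 < ε := by positivity
  set V : Set Circle := {s | |Complex.arg ((s / s₀ : Circle) : ℂ)| < ε} with hV
  have hVn : V ∈ 𝓝 s₀ := by
    have h1 : ContinuousAt (fun s : Circle => |Complex.arg ((s / s₀ : Circle) : ℂ)|) s₀ := by
      have h2 : ContinuousAt (fun s : Circle => ((s / s₀ : Circle) : ℂ)) s₀ :=
        Continuous.continuousAt (by fun_prop)
      refine ContinuousAt.abs (ContinuousAt.comp (g := Complex.arg) ?_ h2)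
      refine Complex.continuousAt_arg ?_
      simp
    refine h1.eventually_lt continuousAt_const ?_
    simpa using hε0
  -- `N + 1` balls of radius `d = 4 ε / N` cover `V`, each of mass at most `4 C d²`; the total is of
  -- order `1 / N`.
  have hsum : ∀ N : ℕ, 0 < N → 4 * ε / N < min 1 (δ / 2) →
      ν.real V ≤ (N + 1) * (4 * C * (4 * ε / N) ^ 2) := by
    intro N hN hd
    have hN' : (0 : ℝ) < N := by exact_mod_cast hN
    set d : ℝ := 4 * ε / N with hddef
    have hd0 : 0 < d := by positivity
    set x : ℕ → ℝ := fun k => -ε + 2 * ε * k / N with hx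
    -- The centres are `2 ε / N = d / 2` apart in angle, so rounding the angle down to a centre
    -- costs less than `d`.
    have hcov : V ⊆ ⋃ k ∈ Finset.range (N + 1), circleBall (s₀ * Circle.exp (x k) : Circle) d := by
      intro s hs
      set θ := Complex.arg ((s / s₀ : Circle) : ℂ) with hθ
      have hsθ : s = s₀ * Circle.exp θ := by rw [hθ, Circle.exp_arg]; simp
      have hθε : |θ| < ε := hs
      rw [abs_lt] at hθε
      have hnn : 0 ≤ (θ + ε) * N / (2 * ε) := by
        have : 0 < θ + ε := by linarith
        positivity
      have hfl := Nat.floor_le hnn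
      have hfl2 := Nat.lt_floor_add_one ((θ + ε) * N / (2 * ε))
      set k := ⌊(θ + ε) * N / (2 * ε)⌋₊ with hk
      have hle : (θ + ε) * N / (2 * ε) < N := by
        rw [div_lt_iff₀ (by positivity)]
        nlinarith
      have hkN : k < N + 1 := by
        have : (k : ℝ) < N := hfl.trans_lt hle
        exact (Nat.cast_lt.1 this).trans (Nat.lt_succ_self N)
      refine mem_biUnion (Finset.mem_coe.2 (Finset.mem_range.2 hkN)) ?_
      change dist (s : ℂ) _ < d
      rw [hsθ]
      refine (dist_circle_mul_exp_le _ _ _).trans_lt ?_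
      rw [le_div_iff₀ (by positivity)] at hfl
      rw [div_lt_iff₀ (by positivity)] at hfl2
      have e1 : 2 * ε * k / N ≤ θ + ε := by
        rw [div_le_iff₀ hN']
        linarith
      have e2 : θ + ε < 2 * ε * k / N + 2 * ε / N := by
        rw [← add_div, lt_div_iff₀ hN']
        linarith
      have e3 : 2 * ε / N < d := by
        rw [hddef]
        gcongr
        linarith
      rw [abs_lt]
      constructor <;> simp only [hx] <;> linarith
    have hpiece : ∀ k ∈ Finset.range (N + 1),
        ν.real (circleBall (s₀ * Circle.exp (x k) : Circle) d) ≤ 4 * C * d ^ 2 := by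
      intro k hk
      have hd1 : d < 1 := hd.trans_le (min_le_left _ _)
      refine (measureReal_circleBall_le ν _ hd0 hd1).trans ?_
      set s : Circle := s₀ * Circle.exp (x k)
      have hz : ‖((1 - d : ℝ) : ℂ) * s‖ = 1 - d := by
        rw [norm_mul, Circle.norm_coe, Complex.norm_real, Real.norm_of_nonneg (by linarith),
          mul_one]
      have hxk : |x k| ≤ ε := by
        have hk' : (k : ℝ) ≤ N := by exact_mod_cast Nat.lt_succ_iff.1 (Finset.mem_range.1 hk)
        have e1 : 2 * ε * k / N ≤ 2 * ε := by
          rw [div_le_iff₀ hN']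
          nlinarith
        have e2 : 0 ≤ 2 * ε * k / N := by positivity
        rw [abs_le]
        constructor <;> simp only [hx] <;> linarith
      have hdist : dist (((1 - d : ℝ) : ℂ) * s) s₀ < δ := by
        have e1 : dist (((1 - d : ℝ) : ℂ) * s) s = d := by
          rw [dist_eq_norm, show ((1 - d : ℝ) : ℂ) * s - s = -((d : ℝ) * s) by push_cast; ring,
            norm_neg, norm_mul, Circle.norm_coe, Complex.norm_real, Real.norm_of_nonneg hd0.le,
            mul_one]
        have e2 := dist_circle_mul_exp_le s₀ (x k) 0
        rw [Circle.exp_zero, mul_one, sub_zero] at e2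
        have e3 := dist_triangle (((1 - d : ℝ) : ℂ) * s) s s₀
        have e4 := hd.trans_le (min_le_right _ _)
        linarith
      have := h _ (by rw [hz]; linarith) hdist
      rw [hz] at this
      calc _ ≤ 4 * d * (C * (1 - (1 - d))) := by gcongr
        _ = _ := by ring
    calc ν.real V ≤ ν.real
          (⋃ k ∈ Finset.range (N + 1), circleBall (s₀ * Circle.exp (x k) : Circle) d) :=
          measureReal_mono hcov (measure_ne_top _ _)
      _ ≤ ∑ k ∈ Finset.range (N + 1), ν.real (circleBall (s₀ * Circle.exp (x k) : Circle) d) :=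
          measureReal_biUnion_finset_le _ _
      _ ≤ ∑ k ∈ Finset.range (N + 1), 4 * C * d ^ 2 := Finset.sum_le_sum hpiece
      _ = _ := by simp
  have hlim : Tendsto (fun N : ℕ => ((N : ℝ) + 1) * (4 * C * (4 * ε / N) ^ 2)) atTop (𝓝 0) := by
    have h1 : Tendsto (fun N : ℕ => (1 / (N : ℝ))) atTop (𝓝 0) := tendsto_one_div_atTop_nhds_zero_nat
    have h2 : Tendsto (fun N : ℕ => 64 * C * ε ^ 2 * (1 / (N : ℝ) + (1 / (N : ℝ)) ^ 2)) atTop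
        (𝓝 (64 * C * ε ^ 2 * (0 + 0 ^ 2))) := (h1.add (h1.pow 2)).const_mul _
    simp only [ne_eq, OfNat.ofNat_ne_zero, not_false_eq_true, zero_pow, add_zero, mul_zero] at h2
    refine h2.congr' ?_
    filter_upwards [eventually_gt_atTop 0] with N hN
    have : (N : ℝ) ≠ 0 := by exact_mod_cast hN.ne'
    field_simp
    ring
  have hd : ∀ᶠ N : ℕ in atTop, 4 * ε / N < min 1 (δ / 2) :=
    (tendsto_const_div_atTop_nhds_zero_nat (4 * ε)).eventually_lt_const (by positivity)
  have hV0 : ν.real V ≤ 0 := by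
    refine ge_of_tendsto hlim ?_
    filter_upwards [hd, eventually_gt_atTop 0] with N h1 h2 using hsum N h2 h1
  obtain ⟨W, hWV, hWo, hW⟩ := mem_nhds_iff.1 hVn
  refine ⟨W, hWo, hW, measure_mono_null hWV ?_⟩
  have := le_antisymm hV0 measureReal_nonneg
  exact (measureReal_eq_zero_iff).1 this

/-! ### The Carathéodory function away from the support -/

/-- `μ` has no mass near the point `z` of the plane. -/
def IsNullNear (hμ : IsMatrixMeasure μ) (z : ℂ) : Prop :=
  ∃ δ > 0, ∀ v, scalarMeasure hμ v (circleBall z δ) = 0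

omit [DecidableEq n] in
lemma isNullNear_of_norm_lt_one (hμ : IsMatrixMeasure μ) {z : ℂ} (hz : ‖z‖ < 1) :
    IsNullNear hμ z :=
  ⟨1 - ‖z‖, sub_pos.2 hz, fun v => by simp [circleBall_eq_empty]⟩

omit [DecidableEq n] in
lemma scalarMeasure_eq_zero (hμ : IsMatrixMeasure μ) (v : n → ℂ) {E : Set Circle}
    (hE : MeasurableSet E) (h : μ E = 0) : scalarMeasure hμ v E = 0 := by
  have := scalarMeasure_real hμ v hE
  rw [h, map_zero] at this
  exact (measureReal_eq_zero_iff).1 (by exact_mod_cast this)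

lemma eq_zero_of_quadForm {A : Matrix n n ℂ} (h : ∀ v, quadForm v A = 0) : A = 0 := by
  ext i j
  rw [apply_eq_polarization A i j]
  simp [h]

lemma eq_zero_of_scalarMeasure (hμ : IsMatrixMeasure μ) {E : Set Circle}
    (hE : MeasurableSet E) (h : ∀ v, scalarMeasure hμ v E = 0) : μ E = 0 :=
  eq_zero_of_quadForm fun v => by
    rw [← scalarMeasure_real hμ v hE]
    simp [Measure.real, h v]

omit [DecidableEq n] in
lemma isNullNear_of_notMem_supp (hμ : IsMatrixMeasure μ) {t : Circle} (ht : t ∉ supp μ) :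
    IsNullNear hμ t := by
  simp only [supp, mem_ofPred_eq, not_forall, not_not] at ht
  obtain ⟨V, hV, htV, h0⟩ := ht
  obtain ⟨δ, hδ, hsub⟩ := Metric.isOpen_iff.1 hV t htV
  exact ⟨δ, hδ, fun v => measure_mono_null hsub (scalarMeasure_eq_zero hμ v hV.measurableSet h0)⟩

omit [DecidableEq n] in
-- Every point off `supp μ` has a null open neighbourhood, and second countability makes the union
-- of these null.
lemma scalarMeasure_compl_supp (hμ : IsMatrixMeasure μ) (v : n → ℂ) :
    scalarMeasure hμ v (supp μ)ᶜ = 0 := by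
  have : SecondCountableTopology Circle := inferInstance
  refine measure_mono_null (fun t ht => ?_) (Measure.measure_compl_support (μ := scalarMeasure hμ v))
  simp only [supp, mem_compl_iff, mem_ofPred_eq, not_forall, not_not] at ht
  obtain ⟨V, hV, htV, h0⟩ := ht
  exact Measure.notMem_support_iff_exists.2
    ⟨V, hV.mem_nhds htV, scalarMeasure_eq_zero hμ v hV.measurableSet h0⟩

omit [DecidableEq n] in
lemma exists_null_punctured (hμ : IsMatrixMeasure μ) {t : Circle} (ht : t ∉ derivedSet (supp μ)) :
    ∃ δ > 0, (∀ s ∈ circleBall t δ, s ≠ t → s ∉ supp μ) ∧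
      ∀ v, scalarMeasure hμ v (circleBall t δ \ {t}) = 0 := by
  rw [mem_derivedSet, accPt_iff_frequently, not_frequently] at ht
  obtain ⟨δ, hδ, hsub⟩ := Metric.eventually_nhds_iff.1 ht
  have h1 : ∀ s ∈ circleBall t δ, s ≠ t → s ∉ supp μ := fun s hs hst hsm =>
    hsub (y := s) hs ⟨hst, hsm⟩
  exact ⟨δ, hδ, h1, fun v =>
    measure_mono_null (fun s hs => h1 s hs.1 hs.2) (scalarMeasure_compl_supp hμ v)⟩

omit [DecidableEq n] in
lemma IsNullNear.eventually {hμ : IsMatrixMeasure μ} {z₀ : ℂ} (h : IsNullNear hμ z₀) :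
    ∀ᶠ z in 𝓝 z₀, IsNullNear hμ z := by
  obtain ⟨δ, hδ, h0⟩ := h
  filter_upwards [Metric.ball_mem_nhds z₀ (half_pos hδ)] with z hz
  refine ⟨δ / 2, half_pos hδ, fun v => measure_mono_null ?_ (h0 v)⟩
  rintro s (hs : dist (s : ℂ) z < δ / 2)
  have := dist_triangle (s : ℂ) z z₀
  rw [Metric.mem_ball] at hz
  change dist (s : ℂ) z₀ < δ
  linarith

omit [DecidableEq n] in
lemma eventually_isNullNear_punctured (hμ : IsMatrixMeasure μ) {t : Circle}
    (ht : t ∉ derivedSet (supp μ)) : ∀ᶠ z in 𝓝[≠] (t : ℂ), IsNullNear hμ z := by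
  obtain ⟨δ, hδ, -, h0⟩ := exists_null_punctured hμ ht
  have h4 : ∀ᶠ z : ℂ in 𝓝[≠] (t : ℂ), z ∈ Metric.ball (t : ℂ) (δ / 2) :=
    nhdsWithin_le_nhds (Metric.ball_mem_nhds _ (half_pos hδ))
  filter_upwards [h4, self_mem_nhdsWithin] with z hz hzt
  have hpos : 0 < dist (t : ℂ) z := dist_pos.2 (Ne.symm hzt)
  refine ⟨min (dist (t : ℂ) z) (δ / 2), lt_min hpos (half_pos hδ), fun v =>
    measure_mono_null ?_ (h0 v)⟩
  rintro s (hs : dist (s : ℂ) z < _)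
  refine ⟨?_, ?_⟩
  · have := dist_triangle (s : ℂ) z t
    rw [Metric.mem_ball] at hz
    have := hs.trans_le (min_le_right _ _)
    change dist (s : ℂ) t < δ
    linarith
  · rintro rfl
    exact (hs.trans_le (min_le_left _ _)).false

lemma IsNullNear.quadForm_caratheodory {hμ : IsMatrixMeasure μ} {z : ℂ} (h : IsNullNear hμ z)
    (v : n → ℂ) : quadForm v (caratheodory μ z) = herglotzTransform (scalarMeasure hμ v) z := by
  obtain ⟨δ, hδ, h0⟩ := h
  exact MatrixSchur.quadForm_caratheodory hμ v hδ h0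

/-- The entries of the Carathéodory function as combinations of scalar Herglotz transforms. -/
def caratheodoryEntry (hμ : IsMatrixMeasure μ) (i j : n) (z : ℂ) : ℂ :=
  (1 / 4) * ∑ k : Fin 4, star (Complex.I ^ (k : ℕ)) *
    herglotzTransform (scalarMeasure hμ (polarVec i j k)) z

lemma IsNullNear.caratheodory_apply {hμ : IsMatrixMeasure μ} {z : ℂ} (h : IsNullNear hμ z)
    (i j : n) : caratheodory μ z i j = caratheodoryEntry hμ i j z := by
  rw [apply_eq_polarization (caratheodory μ z) i j]
  simp only [h.quadForm_caratheodory]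
  rfl

lemma IsNullNear.analyticAt_caratheodory {hμ : IsMatrixMeasure μ} {z₀ : ℂ}
    (h : IsNullNear hμ z₀) (i j : n) : AnalyticAt ℂ (fun z => caratheodory μ z i j) z₀ := by
  have h1 : AnalyticAt ℂ (caratheodoryEntry hμ i j) z₀ := by
    obtain ⟨δ, hδ, h0⟩ := h
    exact analyticAt_const.mul (Finset.analyticAt_fun_sum _ fun k _ =>
      analyticAt_const.mul (analyticAt_herglotzTransform _ hδ (h0 _)))
  refine h1.congr ?_
  filter_upwards [h.eventually] with z hz using (hz.caratheodory_apply i j).symm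

lemma meromorphicAt_caratheodory (hμ : IsMatrixMeasure μ) {t : Circle}
    (ht : t ∉ derivedSet (supp μ)) (i j : n) :
    MeromorphicAt (fun z => caratheodory μ z i j) t := by
  obtain ⟨δ, hδ, -, h0⟩ := exists_null_punctured hμ ht
  have h1 : MeromorphicAt (caratheodoryEntry hμ i j) t :=
    (MeromorphicAt.const _ _).mul (MeromorphicAt.fun_sum fun k _ =>
      (MeromorphicAt.const _ _).mul (meromorphicAt_herglotzTransform _ hδ (h0 _)))
  refine h1.congr ?_
  filter_upwards [eventually_isNullNear_punctured hμ ht] with z hz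
  exact (hz.caratheodory_apply i j).symm

lemma caratheodory_zero (hμ : IsMatrixMeasure μ) (hμ_one : μ univ = 1) :
    caratheodory μ 0 = 1 := by
  refine sub_eq_zero.1 (eq_zero_of_quadForm fun v => ?_)
  rw [map_sub, (isNullNear_of_norm_lt_one hμ (by simp)).quadForm_caratheodory,
    herglotzTransform_zero, scalarMeasure_real hμ v MeasurableSet.univ, hμ_one, sub_self]

lemma re_quadForm_caratheodory_nonneg (hμ : IsMatrixMeasure μ) {z : ℂ} (hz : ‖z‖ < 1)
    (v : n → ℂ) : 0 ≤ (quadForm v (caratheodory μ z)).re := by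
  rw [(isNullNear_of_norm_lt_one hμ hz).quadForm_caratheodory]
  exact re_herglotzTransform_nonneg _ hz

lemma re_quadForm_caratheodory_eq_zero (hμ : IsMatrixMeasure μ) {t : Circle} (ht : t ∉ supp μ)
    (v : n → ℂ) : (quadForm v (caratheodory μ t)).re = 0 := by
  have h := isNullNear_of_notMem_supp hμ ht
  rw [h.quadForm_caratheodory]
  obtain ⟨δ, hδ, h0⟩ := h
  exact re_herglotzTransform_eq_zero _ hδ (h0 v) (Circle.norm_coe t)

lemma tendsto_radial_caratheodory (hμ : IsMatrixMeasure μ) (t : Circle) :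
    Tendsto (fun r : ℝ => ((1 - r) / 2 : ℂ) • caratheodory μ (r * t)) (𝓝[<] 1) (𝓝 (μ {t})) := by
  refine tendsto_pi_nhds.2 fun i => tendsto_pi_nhds.2 fun j => ?_
  have h1 : Tendsto (fun r : ℝ => (1 / 4 : ℂ) * ∑ k : Fin 4, star (Complex.I ^ (k : ℕ)) *
      (((1 - r) / 2 : ℂ) * herglotzTransform (scalarMeasure hμ (polarVec i j k)) (r * t)))
      (𝓝[<] 1) (𝓝 ((1 / 4 : ℂ) * ∑ k : Fin 4, star (Complex.I ^ (k : ℕ)) *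
        ((scalarMeasure hμ (polarVec i j k)).real {t} : ℂ))) :=
    (tendsto_finsetSum _ fun k _ => (tendsto_radial_herglotzTransform _ t).const_mul _).const_mul _
  have h2 : μ {t} i j = (1 / 4 : ℂ) * ∑ k : Fin 4, star (Complex.I ^ (k : ℕ)) *
        ((scalarMeasure hμ (polarVec i j k)).real {t} : ℂ) := by
    rw [apply_eq_polarization (μ {t}) i j]
    simp only [scalarMeasure_real hμ _ (measurableSet_singleton t)]
  rw [h2]
  refine h1.congr' ?_
  filter_upwards [Ioo_mem_nhdsLT one_pos] with r hr
  have hz : ‖(r : ℂ) * t‖ < 1 := by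
    rw [norm_mul, Circle.norm_coe, Complex.norm_real, Real.norm_of_nonneg hr.1.le, mul_one]
    exact hr.2
  rw [Matrix.smul_apply, (isNullNear_of_norm_lt_one hμ hz).caratheodory_apply, caratheodoryEntry,
    smul_eq_mul, Finset.mul_sum, Finset.mul_sum, Finset.mul_sum]
  exact Finset.sum_congr rfl fun k _ => by ring

/-! ### The Cayley transform -/

open Matrix

/-- If `(A + 1) v = 0`, then `v* A v = -v* v`, and the sign of the real part forces `v = 0`. -/
lemma isUnit_add_one {A : Matrix n n ℂ} (h : ∀ v, 0 ≤ (quadForm v A).re) : IsUnit (A + 1) := by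
  rw [← Matrix.mulVec_injective_iff_isUnit]
  refine (injective_iff_map_eq_zero (A + 1).mulVecLin).2 fun v hv => ?_
  rw [Matrix.mulVecLin_apply] at hv
  have h1 : quadForm v A + star v ⬝ᵥ v = 0 := by
    rw [quadForm_apply, ← dotProduct_add, show A *ᵥ v + v = (A + 1) *ᵥ v by
      rw [Matrix.add_mulVec, Matrix.one_mulVec], hv, dotProduct_zero]
  have h2 : 0 ≤ star v ⬝ᵥ v := dotProduct_star_self_nonneg v
  have h3 : star v ⬝ᵥ v = 0 := by
    refine le_antisymm ?_ h2
    rw [Complex.le_def] at h2 ⊢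
    have h4 := congrArg Complex.re h1
    have := h v
    simp only [Complex.add_re, Complex.zero_re] at h4 h2 ⊢
    exact ⟨by linarith, h2.2.symm⟩
  exact dotProduct_star_self_eq_zero.1 h3

/-- The Cayley transform of a matrix. -/
def cayley (A : Matrix n n ℂ) : Matrix n n ℂ := (A - 1) * (A + 1)⁻¹

lemma cayley_mul {A : Matrix n n ℂ} (h : IsUnit (A + 1)) : cayley A * (A + 1) = A - 1 := by
  rw [cayley, Matrix.mul_assoc, Matrix.nonsing_inv_mul _ ((Matrix.isUnit_iff_isUnit_det _).1 h),
    Matrix.mul_one]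

lemma one_sub_cayley {A : Matrix n n ℂ} (h : IsUnit (A + 1)) :
    1 - cayley A = (2 : ℂ) • (A + 1)⁻¹ := by
  have h1 := Matrix.mul_nonsing_inv _ ((Matrix.isUnit_iff_isUnit_det _).1 h)
  rw [cayley]
  refine (congrArg (fun B => B - (A - 1) * (A + 1)⁻¹) h1.symm).trans ?_
  rw [← Matrix.sub_mul, show A + 1 - (A - 1) = (2 : ℂ) • (1 : Matrix n n ℂ) by
    rw [two_smul]; abel]
  rw [Matrix.smul_mul, Matrix.one_mul]

lemma one_add_cayley {A : Matrix n n ℂ} (h : IsUnit (A + 1)) :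
    1 + cayley A = (2 : ℂ) • (A * (A + 1)⁻¹) := by
  have h1 := Matrix.mul_nonsing_inv _ ((Matrix.isUnit_iff_isUnit_det _).1 h)
  rw [cayley]
  refine (congrArg (fun B => B + (A - 1) * (A + 1)⁻¹) h1.symm).trans ?_
  rw [← Matrix.add_mul, show A + 1 + (A - 1) = (2 : ℂ) • A by
    rw [two_smul]; abel]
  rw [Matrix.smul_mul]

lemma mul_one_sub_cayley {A : Matrix n n ℂ} (h : IsUnit (A + 1)) :
    A * (1 - cayley A) = 1 + cayley A := by
  rw [one_sub_cayley h, one_add_cayley h, Matrix.mul_smul]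

lemma one_sub_cayley_mul {A : Matrix n n ℂ} (h : IsUnit (A + 1)) :
    (1 - cayley A) * A = 1 + cayley A := by
  have h1 := cayley_mul h
  rw [Matrix.mul_add, Matrix.mul_one] at h1
  rw [Matrix.sub_mul, Matrix.one_mul, eq_sub_of_add_eq h1]
  abel

lemma isUnit_one_sub_cayley {A : Matrix n n ℂ} (h : IsUnit (A + 1)) : IsUnit (1 - cayley A) := by
  rw [one_sub_cayley h]
  have h2 : IsUnit (A + 1)⁻¹ := Matrix.isUnit_nonsing_inv_iff.2 h
  exact (h2.smul (Units.mk0 (2 : ℂ) two_ne_zero))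

/-- This is `(A + 1)ᴴ (A + 1) - (A - 1)ᴴ (A - 1) = 2 (A + Aᴴ)` after congruence by `(A + 1)⁻¹`. It
yields both contractivity and unitarity of the Cayley transform. -/
lemma one_sub_conjTranspose_cayley_mul {A : Matrix n n ℂ} (h : IsUnit (A + 1)) :
    1 - (cayley A)ᴴ * cayley A = ((A + 1)⁻¹)ᴴ * ((2 : ℂ) • (A + Aᴴ)) * (A + 1)⁻¹ := by
  have h1 := Matrix.mul_nonsing_inv _ ((Matrix.isUnit_iff_isUnit_det _).1 h)
  have h2 : ((A + 1)⁻¹)ᴴ * (A + 1)ᴴ = 1 := by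
    rw [← Matrix.conjTranspose_mul, h1, Matrix.conjTranspose_one]
  have h3 : (1 : Matrix n n ℂ) = ((A + 1)⁻¹)ᴴ * ((A + 1)ᴴ * (A + 1)) * (A + 1)⁻¹ := by
    rw [← Matrix.mul_assoc, h2, Matrix.one_mul, h1]
  have h4 : (cayley A)ᴴ * cayley A = ((A + 1)⁻¹)ᴴ * ((A - 1)ᴴ * (A - 1)) * (A + 1)⁻¹ := by
    simp only [cayley, Matrix.conjTranspose_mul, Matrix.mul_assoc]
  rw [h4]
  refine (congrArg (fun B => B - ((A + 1)⁻¹)ᴴ * ((A - 1)ᴴ * (A - 1)) * (A + 1)⁻¹) h3).trans ?_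
  rw [← Matrix.sub_mul, ← Matrix.mul_sub]
  congr 2
  simp only [Matrix.conjTranspose_add, Matrix.conjTranspose_sub, Matrix.conjTranspose_one, two_smul]
  noncomm_ring

lemma norm_cayley_apply_le {A : Matrix n n ℂ} (h : ∀ v, 0 ≤ (quadForm v A).re) (i j : n) :
    ‖cayley A i j‖ ≤ 1 := by
  have hps : (1 - (cayley A)ᴴ * cayley A).PosSemidef := by
    rw [one_sub_conjTranspose_cayley_mul (isUnit_add_one h)]
    have : ((2 : ℂ) • (A + Aᴴ)).PosSemidef := by
      rw [two_smul]
      exact (posSemidef_add_conjTranspose h).add (posSemidef_add_conjTranspose h)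
    exact this.conjTranspose_mul_mul_same _
  have h1 := (Complex.le_def.1 (hps.diag_nonneg (i := j))).1
  have h2 : ((cayley A)ᴴ * cayley A) j j = ((∑ k, ‖cayley A k j‖ ^ 2 : ℝ) : ℂ) := by
    rw [Matrix.mul_apply]
    push_cast
    refine Finset.sum_congr rfl fun k _ => ?_
    rw [Matrix.conjTranspose_apply]
    exact Complex.conj_mul' _
  rw [Matrix.sub_apply, h2, Matrix.one_apply_eq] at h1
  simp only [Complex.zero_re, Complex.sub_re, Complex.one_re, Complex.ofReal_re] at h1
  have h3 : ‖cayley A i j‖ ^ 2 ≤ ∑ k, ‖cayley A k j‖ ^ 2 :=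
    Finset.single_le_sum (f := fun k => ‖cayley A k j‖ ^ 2) (fun k _ => by positivity)
      (Finset.mem_univ i)
  exact (sq_le_one_iff₀ (norm_nonneg _)).1 (by linarith)

lemma add_conjTranspose_eq_zero {A : Matrix n n ℂ} (h : ∀ v, (quadForm v A).re = 0) :
    A + Aᴴ = 0 := by
  refine eq_zero_of_quadForm fun v => ?_
  have h1 : quadForm v Aᴴ = star (quadForm v A) := by
    rw [quadForm_apply, quadForm_apply, Matrix.dotProduct_mulVec, ← Matrix.star_mulVec,
      Matrix.star_dotProduct]
  rw [map_add, h1]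
  exact Complex.ext (by simp [h v]) (by simp)

lemma cayley_mem_unitaryGroup {A : Matrix n n ℂ} (h : ∀ v, (quadForm v A).re = 0) :
    cayley A ∈ Matrix.unitaryGroup n ℂ := by
  have h1 := one_sub_conjTranspose_cayley_mul (isUnit_add_one fun v => (h v).ge)
  rw [add_conjTranspose_eq_zero h, smul_zero, Matrix.mul_zero, Matrix.zero_mul, sub_eq_zero] at h1
  rw [Matrix.mem_unitaryGroup_iff', Matrix.star_eq_conjTranspose, ← h1]

/-- If `W` is unitary and `A (1 - W) = 1 + W` with `1 - W` invertible, then `A` is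
skew-hermitian. -/
lemma add_conjTranspose_eq_zero_of_unitary {A W : Matrix n n ℂ} (hW : W ∈ Matrix.unitaryGroup n ℂ)
    (hu : IsUnit (1 - W)) (h : A * (1 - W) = 1 + W) : A + Aᴴ = 0 := by
  -- Congruence by `1 - W` turns `A + Aᴴ` into `2 (1 - Wᴴ W)`.
  have h1 : (1 - W)ᴴ * (A + Aᴴ) * (1 - W) = 0 := by
    have e1 : (1 - W)ᴴ * (A + Aᴴ) * (1 - W) =
        (1 - W)ᴴ * (A * (1 - W)) + (A * (1 - W))ᴴ * (1 - W) := by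
      rw [Matrix.conjTranspose_mul]
      noncomm_ring
    have e2 : Wᴴ * W = 1 := Matrix.mem_unitaryGroup_iff'.1 hW
    rw [e1, h]
    simp only [Matrix.conjTranspose_add, Matrix.conjTranspose_sub, Matrix.conjTranspose_one]
    have e3 : (1 - Wᴴ) * (1 + W) + (1 + Wᴴ) * (1 - W) = (2 : ℂ) • (1 - Wᴴ * W) := by
      rw [two_smul]
      noncomm_ring
    rw [e3, e2, sub_self, smul_zero]
  have h2 : IsUnit (1 - W)ᴴ := by
    have := hu.star
    rwa [Matrix.star_eq_conjTranspose] at this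
  have h3 := (hu.mul_left_eq_zero).1 h1
  exact (h2.mul_right_eq_zero).1 h3

/-! ### Analytic and meromorphic matrix functions -/

section MatrixFunctions

variable {M : ℂ → Matrix n n ℂ} {z₀ : ℂ}

lemma meromorphicAt_det (h : ∀ i j, MeromorphicAt (fun z => M z i j) z₀) :
    MeromorphicAt (fun z => (M z).det) z₀ := by
  simp only [Matrix.det_apply]
  exact MeromorphicAt.fun_sum fun σ _ =>
    (MeromorphicAt.fun_prod fun i _ => h _ _).const_smul _

lemma analyticAt_det (h : ∀ i j, AnalyticAt ℂ (fun z => M z i j) z₀) :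
    AnalyticAt ℂ (fun z => (M z).det) z₀ := by
  simp only [Matrix.det_apply']
  exact Finset.analyticAt_fun_sum _ fun σ _ =>
    analyticAt_const.mul (Finset.analyticAt_fun_prod _ fun i _ => h _ _)

/-- Cramer's rule reduces inverses to determinants. It also covers singular `A`, where both sides
are `0`, so meromorphy of the inverse needs no invertibility. -/
lemma inv_apply_eq (A : Matrix n n ℂ) (i j : n) :
    A⁻¹ i j = A.det⁻¹ * (A.updateRow j (Pi.single i 1)).det := by
  rw [Matrix.inv_def, Matrix.smul_apply, Ring.inverse_eq_inv', Matrix.adjugate_apply, smul_eq_mul]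

lemma meromorphicAt_inv (h : ∀ i j, MeromorphicAt (fun z => M z i j) z₀) (i j : n) :
    MeromorphicAt (fun z => (M z)⁻¹ i j) z₀ := by
  simp only [inv_apply_eq]
  refine (meromorphicAt_det h).inv.mul (meromorphicAt_det fun k l => ?_)
  by_cases hk : k = j
  · subst hk
    simp
  · simpa [Matrix.updateRow_ne hk] using h k l

lemma analyticAt_inv (h : ∀ i j, AnalyticAt ℂ (fun z => M z i j) z₀) (hu : IsUnit (M z₀))
    (i j : n) : AnalyticAt ℂ (fun z => (M z)⁻¹ i j) z₀ := by
  simp only [inv_apply_eq]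
  have h0 : (M z₀).det ≠ 0 := ((Matrix.isUnit_iff_isUnit_det _).1 hu).ne_zero
  refine ((analyticAt_det h).inv h0).mul (analyticAt_det fun k l => ?_)
  by_cases hk : k = j
  · subst hk
    simpa using analyticAt_const
  · simpa [Matrix.updateRow_ne hk] using h k l

omit [DecidableEq n] in
lemma analyticAt_mul {N : ℂ → Matrix n n ℂ} (hM : ∀ i j, AnalyticAt ℂ (fun z => M z i j) z₀)
    (hN : ∀ i j, AnalyticAt ℂ (fun z => N z i j) z₀) (i j : n) :
    AnalyticAt ℂ (fun z => (M z * N z) i j) z₀ := by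
  simp only [Matrix.mul_apply]
  exact Finset.analyticAt_fun_sum _ fun k _ => (hM _ _).mul (hN _ _)

omit [DecidableEq n] in
lemma meromorphicAt_mul {N : ℂ → Matrix n n ℂ} (hM : ∀ i j, MeromorphicAt (fun z => M z i j) z₀)
    (hN : ∀ i j, MeromorphicAt (fun z => N z i j) z₀) (i j : n) :
    MeromorphicAt (fun z => (M z * N z) i j) z₀ := by
  simp only [Matrix.mul_apply]
  exact MeromorphicAt.fun_sum fun k _ => (hM _ _).mul (hN _ _)

lemma meromorphicAt_cayley (h : ∀ i j, MeromorphicAt (fun z => M z i j) z₀) (i j : n) :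
    MeromorphicAt (fun z => cayley (M z) i j) z₀ :=
  meromorphicAt_mul (fun i j => (h i j).sub (.const _ _))
    (meromorphicAt_inv fun i j => (h i j).add (.const _ _)) i j

lemma analyticAt_cayley (h : ∀ i j, AnalyticAt ℂ (fun z => M z i j) z₀) (hu : IsUnit (M z₀ + 1))
    (i j : n) : AnalyticAt ℂ (fun z => cayley (M z) i j) z₀ :=
  analyticAt_mul (fun i j => (h i j).sub analyticAt_const)
    (analyticAt_inv (fun i j => (h i j).add analyticAt_const) hu) i j

omit [Fintype n] [DecidableEq n] in
lemma continuousAt_of_analyticAt_apply (h : ∀ i j, AnalyticAt ℂ (fun z => M z i j) z₀) :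
    ContinuousAt M z₀ :=
  continuousAt_pi.2 fun i => continuousAt_pi.2 fun j => (h i j).continuousAt

end MatrixFunctions

/-! ### Removable singularities -/

/-- `h` extends analytically to the point `z`. -/
def IsRemovable (h : ℂ → Matrix n n ℂ) (z : ℂ) : Prop :=
  ∃ φ : ℂ → Matrix n n ℂ, (∀ i j, AnalyticAt ℂ (fun w => φ w i j) z) ∧ h =ᶠ[𝓝[≠] z] φ

/-- The function obtained from `h` by removing all removable singularities. -/
def fillIn (h : ℂ → Matrix n n ℂ) (z : ℂ) : Matrix n n ℂ := limUnder (𝓝[≠] z) h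

section Removable

variable {h φ : ℂ → Matrix n n ℂ} {z : ℂ}

omit [DecidableEq n] in
lemma eventually_isRemovable (hφ : ∀ i j, AnalyticAt ℂ (fun w => φ w i j) z)
    (he : h =ᶠ[𝓝[≠] z] φ) : ∀ᶠ w in 𝓝 z,
      (∀ i j, AnalyticAt ℂ (fun w => φ w i j) w) ∧ h =ᶠ[𝓝[≠] w] φ := by
  have h1 : ∀ᶠ w in 𝓝 z, ∀ i j, AnalyticAt ℂ (fun w => φ w i j) w :=
    eventually_all.2 fun i => eventually_all.2 fun j => (hφ i j).eventually_analyticAt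
  have h2 : ∀ᶠ w in 𝓝 z, ∀ᶠ u in 𝓝 w, u ≠ z → h u = φ u :=
    eventually_eventually_nhds.2 (eventually_nhdsWithin_iff.1 he)
  filter_upwards [h1, h2] with w hw1 hw2
  refine ⟨hw1, ?_⟩
  by_cases hwz : w = z
  · rw [hwz]
    exact he
  · have h3 : ∀ᶠ u in 𝓝 w, u ≠ z := isOpen_ne.mem_nhds hwz
    refine (Filter.Eventually.filter_mono nhdsWithin_le_nhds ?_)
    filter_upwards [hw2, h3] with u hu1 hu2 using hu1 hu2

omit [DecidableEq n] [Fintype n] in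
lemma fillIn_eq (hφ : ∀ i j, AnalyticAt ℂ (fun w => φ w i j) z) (he : h =ᶠ[𝓝[≠] z] φ) :
    fillIn h z = φ z := by
  have h1 : Tendsto φ (𝓝[≠] z) (𝓝 (φ z)) :=
    (continuousAt_of_analyticAt_apply hφ).tendsto.mono_left nhdsWithin_le_nhds
  exact (h1.congr' he.symm).limUnder_eq

omit [DecidableEq n] in
lemma fillIn_eventuallyEq (hφ : ∀ i j, AnalyticAt ℂ (fun w => φ w i j) z)
    (he : h =ᶠ[𝓝[≠] z] φ) : fillIn h =ᶠ[𝓝 z] φ := by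
  filter_upwards [eventually_isRemovable hφ he] with w hw using fillIn_eq hw.1 hw.2

omit [DecidableEq n] in
lemma isOpen_isRemovable (h : ℂ → Matrix n n ℂ) : IsOpen {z | IsRemovable h z} := by
  rw [isOpen_iff_mem_nhds]
  rintro z ⟨φ, hφ, he⟩
  filter_upwards [eventually_isRemovable hφ he] with w hw using ⟨φ, hw⟩

omit [DecidableEq n] in
lemma IsRemovable.analyticAt_fillIn (hz : IsRemovable h z) (i j : n) :
    AnalyticAt ℂ (fun w => fillIn h w i j) z := by
  obtain ⟨φ, hφ, he⟩ := hz
  refine (hφ i j).congr ?_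
  filter_upwards [fillIn_eventuallyEq hφ he] with w hw
  rw [hw]

omit [DecidableEq n] in
lemma IsRemovable.fillIn_eventuallyEq (hz : IsRemovable h z) : h =ᶠ[𝓝[≠] z] fillIn h := by
  obtain ⟨φ, hφ, he⟩ := hz
  filter_upwards [he, nhdsWithin_le_nhds (MatrixSchur.fillIn_eventuallyEq hφ he)] with w h1 h2
  rw [h1, h2]

/-- A function which is meromorphic at `z` and bounded along some filter approaching `z` extends
analytically to `z`. -/
lemma exists_analyticAt_of_meromorphicAt_of_bounded {f : ℂ → ℂ} {z : ℂ} (hf : MeromorphicAt f z)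
    {l : Filter ℂ} [l.NeBot] (hl : l ≤ 𝓝[≠] z) {C : ℝ} (hb : ∀ᶠ w in l, ‖f w‖ ≤ C) :
    ∃ φ : ℂ → ℂ, AnalyticAt ℂ φ z ∧ f =ᶠ[𝓝[≠] z] φ := by
  refine ⟨toMeromorphicNFAt f z, ?_, hf.eq_nhdsNE_toMeromorphicNFAt⟩
  rw [← hf.meromorphicOrderAt_nonneg_iff_analyticAt_toMeromorphicNFAt]
  by_contra hneg
  -- A pole would send the norm to infinity along `l` as well.
  have h1 := (tendsto_norm_atTop_iff_cobounded.2
    (tendsto_cobounded_of_meromorphicOrderAt_neg (not_le.1 hneg))).mono_left hl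
  obtain ⟨w, hw1, hw2⟩ := (hb.and (h1.eventually_gt_atTop C)).exists
  linarith

end Removable

/-! ### Continuation of the Schur function off the limit points -/

/-- The Schur function before the removal of singularities. -/
def preSchur (μ : VectorMeasure Circle (Matrix n n ℂ)) (z : ℂ) : Matrix n n ℂ :=
  z⁻¹ • cayley (caratheodory μ z)

lemma schur_zero : schur μ 0 = fillIn (preSchur μ) 0 := by
  rw [schur, Function.update_self]
  rfl

lemma schur_of_ne_zero {z : ℂ} (hz : z ≠ 0) : schur μ z = preSchur μ z := by
  rw [schur, Function.update_of_ne hz]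
  rfl

lemma isUnit_caratheodory_add_one (hμ : IsMatrixMeasure μ) {z : ℂ} (hz : ‖z‖ < 1) :
    IsUnit (caratheodory μ z + 1) :=
  isUnit_add_one (re_quadForm_caratheodory_nonneg hμ hz)

lemma analyticAt_cayley_caratheodory (hμ : IsMatrixMeasure μ) {z : ℂ} (hz : ‖z‖ < 1) (i j : n) :
    AnalyticAt ℂ (fun w => cayley (caratheodory μ w) i j) z :=
  analyticAt_cayley (isNullNear_of_norm_lt_one hμ hz).analyticAt_caratheodory
    (isUnit_caratheodory_add_one hμ hz) i j

lemma cayley_caratheodory_zero (hμ : IsMatrixMeasure μ) (hμ_one : μ univ = 1) :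
    cayley (caratheodory μ 0) = 0 := by
  rw [caratheodory_zero hμ hμ_one, cayley, sub_self, Matrix.zero_mul]

lemma smul_schur (hμ : IsMatrixMeasure μ) (hμ_one : μ univ = 1) (z : ℂ) :
    z • schur μ z = cayley (caratheodory μ z) := by
  by_cases hz : z = 0
  · rw [hz, cayley_caratheodory_zero hμ hμ_one, zero_smul]
  · rw [schur_of_ne_zero hz, preSchur, smul_smul, mul_inv_cancel₀ hz, one_smul]

lemma analyticAt_preSchur (hμ : IsMatrixMeasure μ) {z : ℂ} (hz : ‖z‖ < 1) (h0 : z ≠ 0) (i j : n) :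
    AnalyticAt ℂ (fun w => preSchur μ w i j) z :=
  (analyticAt_id.inv h0).mul (analyticAt_cayley_caratheodory hμ hz i j)

lemma isRemovable_preSchur_of_norm_lt_one (hμ : IsMatrixMeasure μ) (hμ_one : μ univ = 1) {z : ℂ}
    (hz : ‖z‖ < 1) : IsRemovable (preSchur μ) z := by
  by_cases h0 : z = 0
  · subst h0
    -- The Cayley transform of `F` vanishes at `0` because `F(0) = 1`, so dividing by `z` is a
    -- difference quotient.
    refine ⟨fun w => Matrix.of fun i j => dslope (fun w => cayley (caratheodory μ w) i j) 0 w,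
      fun i j => ?_, ?_⟩
    · obtain ⟨p, hp⟩ := analyticAt_cayley_caratheodory hμ hz i j
      exact hp.has_fpower_series_dslope_fslope.analyticAt
    · filter_upwards [self_mem_nhdsWithin] with w hw
      ext i j
      rw [Matrix.of_apply, dslope_of_ne _ hw, slope_def_module, cayley_caratheodory_zero hμ hμ_one]
      simp [preSchur]
  · exact ⟨preSchur μ, analyticAt_preSchur hμ hz h0, EventuallyEq.rfl⟩

lemma fillIn_preSchur_eq_schur (hμ : IsMatrixMeasure μ) {z : ℂ} (hz : ‖z‖ < 1) :
    fillIn (preSchur μ) z = schur μ z := by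
  by_cases h0 : z = 0
  · rw [h0, schur_zero]
  · rw [schur_of_ne_zero h0]
    exact fillIn_eq (analyticAt_preSchur hμ hz h0) EventuallyEq.rfl

lemma tendsto_radial (t : Circle) : Tendsto (fun r : ℝ => (r : ℂ) * t) (𝓝[<] 1) (𝓝[≠] (t : ℂ)) := by
  refine tendsto_nhdsWithin_iff.2 ⟨?_, ?_⟩
  · have : Continuous fun r : ℝ => (r : ℂ) * t := by fun_prop
    have h1 := (this.tendsto 1).mono_left (nhdsWithin_le_nhds (s := Iio 1))
    simpa using h1
  · filter_upwards [self_mem_nhdsWithin] with r (hr : r < 1)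
    simpa using hr.ne

lemma eventually_norm_radial_lt (t : Circle) :
    ∀ᶠ r : ℝ in 𝓝[<] 1, ‖(r : ℂ) * t‖ < 1 := by
  filter_upwards [Ioo_mem_nhdsLT one_pos] with r hr
  rw [norm_mul, Circle.norm_coe, Complex.norm_real, Real.norm_of_nonneg hr.1.le, mul_one]
  exact hr.2

/-- Every entry is meromorphic at `t`, and contractivity bounds it by `2` on the part `r > 1 / 2` of
the radius to `t`, which excludes a pole. -/
lemma isRemovable_preSchur_of_notMem_derivedSet (hμ : IsMatrixMeasure μ) {t : Circle}
    (ht : t ∉ derivedSet (supp μ)) : IsRemovable (preSchur μ) t := by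
  have hmer : ∀ i j, MeromorphicAt (fun w => preSchur μ w i j) t := fun i j =>
    (MeromorphicAt.id _).inv.mul (meromorphicAt_cayley (meromorphicAt_caratheodory hμ ht) i j)
  have hb : ∀ i j, ∀ᶠ w in map (fun r : ℝ => (r : ℂ) * t) (𝓝[<] 1), ‖preSchur μ w i j‖ ≤ 2 := by
    intro i j
    rw [eventually_map]
    filter_upwards [Ioo_mem_nhdsLT (show (1 / 2 : ℝ) < 1 by norm_num)] with r hr
    have hz : ‖(r : ℂ) * t‖ = r := by
      rw [norm_mul, Circle.norm_coe, Complex.norm_real,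
        Real.norm_of_nonneg (by linarith [hr.1]), mul_one]
    have h1 := norm_cayley_apply_le
      (re_quadForm_caratheodory_nonneg hμ (z := r * t) (by rw [hz]; exact hr.2)) i j
    rw [preSchur, Matrix.smul_apply, smul_eq_mul, norm_mul, norm_inv, hz]
    have h2 : r⁻¹ ≤ 2 := by
      rw [inv_le_comm₀ (by linarith [hr.1]) two_pos]
      linarith [hr.1]
    calc r⁻¹ * _ ≤ 2 * 1 := by gcongr
      _ = 2 := mul_one 2
  choose φ hφ he using fun i j =>
    exists_analyticAt_of_meromorphicAt_of_bounded (hmer i j) (tendsto_radial t) (hb i j)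
  refine ⟨fun w => Matrix.of fun i j => φ i j w, hφ, ?_⟩
  have : ∀ᶠ w in 𝓝[≠] (t : ℂ), ∀ i j, preSchur μ w i j = φ i j w :=
    eventually_all.2 fun i => eventually_all.2 fun j => he i j
  filter_upwards [this] with w hw
  ext i j
  exact hw i j

lemma neBot_nhdsNE_circle (t : Circle) : (𝓝[≠] t).NeBot := by
  have h1 : (univ : Set Circle).Nontrivial :=
    ⟨1, mem_univ _, Circle.exp Real.pi, mem_univ _, fun h => by
      have := congrArg (fun s : Circle => (s : ℂ)) h
      norm_num [Circle.coe_exp] at this⟩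
  have h2 : AccPt t (𝓟 univ) := isPreconnected_univ.preperfect_of_nontrivial h1 t (mem_univ t)
  simpa [AccPt] using h2

lemma tendsto_coe_circle_punctured (t : Circle) :
    Tendsto (fun s : Circle => (s : ℂ)) (𝓝[≠] t) (𝓝[≠] (t : ℂ)) := by
  refine tendsto_nhdsWithin_iff.2 ⟨?_, ?_⟩
  · exact ((by fun_prop : Continuous fun s : Circle => (s : ℂ)).tendsto t).mono_left
      nhdsWithin_le_nhds
  · filter_upwards [self_mem_nhdsWithin] with s hs
    simpa [Circle.coe_inj] using hs

lemma preSchur_mem_unitaryGroup (hμ : IsMatrixMeasure μ) {t : Circle} (ht : t ∉ supp μ) :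
    preSchur μ t ∈ Matrix.unitaryGroup n ℂ := by
  have h1 := cayley_mem_unitaryGroup (re_quadForm_caratheodory_eq_zero hμ ht)
  rw [Matrix.mem_unitaryGroup_iff] at h1 ⊢
  have h2 : (t : ℂ) * star (t : ℂ) = 1 := by
    have := Complex.mul_conj (t : ℂ)
    rw [Circle.normSq_coe] at this
    simpa using this
  rw [preSchur, star_smul, Matrix.smul_mul, Matrix.mul_smul, h1, smul_smul, star_inv₀, ← mul_inv,
    h2, inv_one, one_smul]

/-- The point `t` may carry mass, and then `F` is singular at `t`. The nearby points of the circle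
are off the support, where the values are unitary, and unitarity passes to the limit. -/
lemma fillIn_preSchur_mem_unitaryGroup (hμ : IsMatrixMeasure μ) {t : Circle}
    (ht : t ∉ derivedSet (supp μ)) : fillIn (preSchur μ) t ∈ Matrix.unitaryGroup n ℂ := by
  have hrem := isRemovable_preSchur_of_notMem_derivedSet hμ ht
  have hne : (𝓝[≠] t).NeBot := neBot_nhdsNE_circle t
  have hc : Tendsto (fun s : Circle => fillIn (preSchur μ) s * star (fillIn (preSchur μ) s))
      (𝓝[≠] t) (𝓝 (fillIn (preSchur μ) t * star (fillIn (preSchur μ) t))) := by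
    have h1 : ContinuousAt (fillIn (preSchur μ)) (t : ℂ) :=
      continuousAt_of_analyticAt_apply hrem.analyticAt_fillIn
    have h2 : Continuous fun A : Matrix n n ℂ => A * star A := by
      simp only [Matrix.star_eq_conjTranspose]
      fun_prop
    exact (h2.continuousAt.tendsto.comp h1.tendsto).comp
      ((tendsto_coe_circle_punctured t).mono_right nhdsWithin_le_nhds)
  rw [Matrix.mem_unitaryGroup_iff]
  refine tendsto_nhds_unique hc (tendsto_const_nhds.congr' ?_)
  obtain ⟨δ, hδ, hs, -⟩ := exists_null_punctured hμ ht
  have h1 : ∀ᶠ s in 𝓝[≠] t, s ∈ circleBall (t : ℂ) δ := by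
    refine nhdsWithin_le_nhds ((isOpen_circleBall _ _).mem_nhds ?_)
    simpa [circleBall] using hδ
  filter_upwards [h1, self_mem_nhdsWithin,
    (tendsto_coe_circle_punctured t).eventually hrem.fillIn_eventuallyEq] with s h2 h3 h4
  rw [← h4]
  exact (Matrix.mem_unitaryGroup_iff.1 (preSchur_mem_unitaryGroup hμ (hs s h2 h3))).symm

lemma hasUnitaryContinuation_compl_derivedSet (hμ : IsMatrixMeasure μ) (hμ_one : μ univ = 1) :
    HasUnitaryContinuation (schur μ) (derivedSet (supp μ))ᶜ := by
  refine ⟨{z | IsRemovable (preSchur μ) z}, fillIn (preSchur μ),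
    ⟨isOpen_isRemovable _, fun z hz => ?_, fun i j z hz => ?_, fun z hz => ?_⟩, fun t ht => ⟨?_, ?_⟩⟩
  · exact isRemovable_preSchur_of_norm_lt_one hμ hμ_one (mem_ball_zero_iff.1 hz)
  · exact IsRemovable.analyticAt_fillIn hz i j
  · exact fillIn_preSchur_eq_schur hμ (mem_ball_zero_iff.1 hz)
  · exact isRemovable_preSchur_of_notMem_derivedSet hμ ht
  · exact fillIn_preSchur_mem_unitaryGroup hμ ht

/-! ### Point masses and the kernel of `1 - t f(t)` -/

variable {U : Set ℂ} {g : ℂ → Matrix n n ℂ}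

lemma IsAnalyticContinuation.smul_eq_cayley (hg : IsAnalyticContinuation (schur μ) U g)
    (hμ : IsMatrixMeasure μ) (hμ_one : μ univ = 1) {z : ℂ} (hz : ‖z‖ < 1) :
    z • g z = cayley (caratheodory μ z) := by
  rw [hg.2.2.2 (mem_ball_zero_iff.2 hz), smul_schur hμ hμ_one]

/-- The mass at a point `t` through which the Schur function continues analytically is governed by
the kernel of `1 - t f(t)`. -/
lemma range_eq_ker (hμ : IsMatrixMeasure μ) (hμ_one : μ univ = 1)
    (hg : IsAnalyticContinuation (schur μ) U g) {t : Circle} (htU : (t : ℂ) ∈ U) :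
    LinearMap.range (μ {t}).mulVecLin = LinearMap.ker (1 - (t : ℂ) • g (t : ℂ)).mulVecLin := by
  have hga : ∀ i j, AnalyticAt ℂ (fun z => g z i j) t := fun i j => hg.2.2.1 i j t htU
  have hgc : ContinuousAt g t := continuousAt_of_analyticAt_apply hga
  have hrad : Tendsto (fun r : ℝ => (r : ℂ) * t) (𝓝[<] 1) (𝓝 (t : ℂ)) :=
    (tendsto_radial t).mono_right nhdsWithin_le_nhds
  have hF := tendsto_radial_caratheodory hμ t
  have hWc : ContinuousAt (fun z => z • g z) (t : ℂ) := continuousAt_id.smul hgc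
  have hW := hWc.tendsto.comp hrad
  have hc0 : Tendsto (fun r : ℝ => ((1 - r) / 2 : ℂ)) (𝓝[<] 1) (𝓝 0) := by
    have : Continuous fun r : ℝ => ((1 - r) / 2 : ℂ) := by fun_prop
    simpa using (this.tendsto 1).mono_left (nhdsWithin_le_nhds (s := Iio 1))
  -- Multiply `(1 - W) F = 1 + W` at `r t` by `(1 - r) / 2`: the left side tends to `(1 - W(t)) μ
  -- {t}`, the right side to `0`.
  have hzero : (1 - (t : ℂ) • g t) * μ {t} = 0 := by
    refine tendsto_nhds_unique ((tendsto_const_nhds.sub hW).mul hF) ?_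
    have h1 := hc0.smul ((tendsto_const_nhds (x := (1 : Matrix n n ℂ))).add hW)
    rw [zero_smul] at h1
    refine h1.congr' ?_
    filter_upwards [eventually_norm_radial_lt t] with r hr
    simp only [Function.comp_apply]
    rw [hg.smul_eq_cayley hμ hμ_one hr, Matrix.mul_smul,
      one_sub_cayley_mul (isUnit_caratheodory_add_one hμ hr)]
  refine le_antisymm ?_ ?_
  · rintro _ ⟨u, rfl⟩
    rw [LinearMap.mem_ker, Matrix.mulVecLin_apply, Matrix.mulVecLin_apply, Matrix.mulVec_mulVec,
      hzero, Matrix.zero_mulVec]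
  · intro v hv
    rw [LinearMap.mem_ker, Matrix.mulVecLin_apply] at hv
    set φ : n → ℂ → ℂ := fun i z => ((1 - z • g z) *ᵥ v) i with hφ
    have hφa : ∀ i, AnalyticAt ℂ (φ i) t := fun i => by
      simp only [hφ, Matrix.mulVec, dotProduct]
      refine Finset.analyticAt_fun_sum _ fun j _ => AnalyticAt.mul ?_ analyticAt_const
      exact analyticAt_const.sub (analyticAt_id.mul (hga i j))
    -- Since `(1 - W(z)) v` vanishes at `t`, it is `(z - t) ψ z` with `ψ` continuous at `t`; this
    -- zero compensates the growth of `F`.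
    set ψ : ℂ → n → ℂ := fun z i => dslope (φ i) t z with hψ
    have hψc : ContinuousAt ψ t := continuousAt_pi.2 fun i =>
      continuousAt_dslope_same.2 (hφa i).differentiableAt
    have hφψ : ∀ z, (1 - z • g z) *ᵥ v = (z - t) • ψ z := fun z => by
      ext i
      have h1 := sub_smul_dslope (φ i) t z
      have h2 : φ i t = 0 := congrFun hv i
      rw [h2, sub_zero] at h1
      exact h1.symm
    have hψr := hψc.tendsto.comp hrad
    have hlim1 : Tendsto (fun r : ℝ => (-2 * t : ℂ) •
        ((((1 - r) / 2 : ℂ) • caratheodory μ (r * t)) *ᵥ ψ (r * t))) (𝓝[<] 1)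
        (𝓝 ((-2 * t : ℂ) • (μ {t} *ᵥ ψ t))) := by
      have h1 : Continuous fun p : Matrix n n ℂ × (n → ℂ) => p.1 *ᵥ p.2 :=
        continuous_fst.matrix_mulVec continuous_snd
      exact ((h1.tendsto (μ {t}, ψ t)).comp (hF.prodMk_nhds hψr)).const_smul _
    have hlim2 : Tendsto (fun r : ℝ => (1 + ((r : ℂ) * t) • g (r * t)) *ᵥ v) (𝓝[<] 1)
        (𝓝 ((1 + (t : ℂ) • g t) *ᵥ v)) := by
      have h1 : Continuous fun A : Matrix n n ℂ => (1 + A) *ᵥ v :=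
        (continuous_const.add continuous_id).matrix_mulVec continuous_const
      exact (h1.tendsto _).comp hW
    -- Apply `F (1 - W) = 1 + W` to `v`; here `r t - t = -2 t (1 - r) / 2` supplies the factor under
    -- which `F(r t)` converges.
    have hkey : (-2 * t : ℂ) • (μ {t} *ᵥ ψ t) = (1 + (t : ℂ) • g t) *ᵥ v := by
      refine tendsto_nhds_unique hlim1 (hlim2.congr' ?_)
      filter_upwards [eventually_norm_radial_lt t] with r hr
      have h1 := hφψ (r * t)
      have h2 : ((r : ℂ) * t - t) = (-2 * t) * ((1 - r) / 2) := by ring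
      rw [Matrix.smul_mulVec, smul_smul, ← h2, ← Matrix.mulVec_smul, ← h1, Matrix.mulVec_mulVec,
        hg.smul_eq_cayley hμ hμ_one hr, mul_one_sub_cayley (isUnit_caratheodory_add_one hμ hr)]
    have h2v : (1 + (t : ℂ) • g t) *ᵥ v = (2 : ℂ) • v := by
      rw [Matrix.sub_mulVec, Matrix.one_mulVec, sub_eq_zero] at hv
      rw [Matrix.add_mulVec, Matrix.one_mulVec, ← hv, two_smul]
    rw [h2v] at hkey
    -- As `W(t) v = v`, `hkey` reads `-2 t μ {t} ψ(t) = 2 v`; half of it exhibits `v` in the range.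
    refine ⟨(-t : ℂ) • ψ t, ?_⟩
    rw [Matrix.mulVecLin_apply, Matrix.mulVec_smul]
    have h3 : v = (1 / 2 : ℂ) • ((2 : ℂ) • v) := by rw [smul_smul]; norm_num
    rw [h3, ← hkey, smul_smul]
    congr 1
    ring

lemma mem_supp_of_apply_singleton_ne_zero (hμ : IsMatrixMeasure μ) {t : Circle}
    (ht : μ {t} ≠ 0) : t ∈ supp μ := by
  intro V hV htV h0
  refine ht (eq_zero_of_scalarMeasure hμ (measurableSet_singleton t) fun v => ?_)
  exact measure_mono_null (singleton_subset_iff.2 htV)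
    (scalarMeasure_eq_zero hμ v hV.measurableSet h0)

/-- A point of nonzero mass lies in the support automatically, so being isolated there amounts to
not being a limit point. -/
lemma isIsolatedMassPoint_iff (hμ : IsMatrixMeasure μ) (t : Circle) :
    IsIsolatedMassPoint μ t ↔ t ∉ derivedSet (supp μ) ∧ μ {t} ≠ 0 := by
  rw [mem_derivedSet, accPt_iff_frequently, not_frequently]
  constructor
  · rintro ⟨h0, V, hV, hVs⟩
    refine ⟨?_, h0⟩
    have htV : t ∈ V := (hVs.ge (mem_singleton t)).1
    filter_upwards [hV.mem_nhds htV] with s hs hs'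
    exact hs'.1 (hVs.le ⟨hs, hs'.2⟩)
  · rintro ⟨h, h0⟩
    obtain ⟨V, hVs, hV, htV⟩ := mem_nhds_iff.1 h
    refine ⟨h0, V, hV, Subset.antisymm (fun s hs => ?_) (singleton_subset_iff.2
      ⟨htV, mem_supp_of_apply_singleton_ne_zero hμ h0⟩)⟩
    by_contra hst
    exact hVs hs.1 ⟨hst, hs.2⟩

lemma apply_singleton_eq_zero_iff (hμ : IsMatrixMeasure μ) (hμ_one : μ univ = 1)
    (hg : IsAnalyticContinuation (schur μ) U g) {t : Circle} (htU : (t : ℂ) ∈ U) :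
    μ {t} = 0 ↔ (1 - (t : ℂ) • g (t : ℂ)).det ≠ 0 := by
  have h1 : μ {t} = 0 ↔ LinearMap.range (μ {t}).mulVecLin = ⊥ := by
    rw [LinearMap.range_eq_bot]
    exact ⟨fun h => by rw [h, Matrix.mulVecLin_zero],
      fun h => Matrix.toLin'.injective (by rw [Matrix.toLin'_apply', h, map_zero])⟩
  rw [h1, range_eq_ker hμ hμ_one hg htU, LinearMap.ker_eq_bot, ← isUnit_iff_ne_zero,
    ← Matrix.isUnit_iff_isUnit_det, ← Matrix.mulVec_injective_iff_isUnit]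
  rfl

/-! ### Arcs of unitary values contain no limit points of the support -/

/-- Every point of an open subset of the circle lies in an arc contained in that subset. -/
lemma exists_isArc_subset {S : Set Circle} (hS : IsOpen S) {t : Circle} (ht : t ∈ S) :
    ∃ Γ ⊆ S, IsArc Γ ∧ t ∈ Γ := by
  have hpre : IsOpen (Circle.exp ⁻¹' S) := hS.preimage Circle.exp.continuous
  have hθ : Complex.arg (t : ℂ) ∈ Circle.exp ⁻¹' S := by
    rw [mem_preimage, Circle.exp_arg]
    exact ht
  obtain ⟨ε, hε, hsub⟩ := Metric.isOpen_iff.1 hpre _ hθ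
  set θ := Complex.arg (t : ℂ) with hθdef
  -- A length of at most `1` keeps `Circle.exp` injective, so the arc is nondegenerate.
  set η : ℝ := min (ε / 2) 1 with hη
  have hη0 : 0 < η := lt_min (half_pos hε) one_pos
  refine ⟨Circle.exp '' Icc θ (θ + η), ?_, ⟨?_, ?_⟩, ?_⟩
  · rintro _ ⟨x, hx, rfl⟩
    refine hsub ?_
    rw [Metric.mem_ball, Real.dist_eq, abs_of_nonneg (by linarith [hx.1])]
    have := min_le_left (ε / 2) 1
    linarith [hx.2]
  · exact (isConnected_Icc (by linarith)).image _ Circle.exp.continuous.continuousOn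
  · have hinj : InjOn Circle.exp (Icc θ (θ + η)) := Circle.exp_injOn_Icc (by
      have := min_le_right (ε / 2) 1
      linarith [Real.pi_gt_three])
    exact (show (Icc θ (θ + η)).Nontrivial from
      ⟨θ, ⟨le_rfl, by linarith⟩, θ + η, ⟨by linarith, le_rfl⟩, by linarith⟩).image_of_injOn hinj
  · exact ⟨θ, ⟨le_rfl, by linarith⟩, Circle.exp_arg t⟩

/-- A function which is analytic near `t` and unitary on a subset of the circle accumulating at
`t` is unitary on the circle near `t`. -/
lemma eventually_mem_unitaryGroup {t : Circle} (hga : ∀ i j, AnalyticAt ℂ (fun z => g z i j) t)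
    (hfr : ∃ᶠ s : Circle in 𝓝[≠] t, g (s : ℂ) ∈ Matrix.unitaryGroup n ℂ) :
    ∀ᶠ s : Circle in 𝓝 t, g (s : ℂ) ∈ Matrix.unitaryGroup n ℂ := by
  have hconj : ∀ s : Circle, (starRingEnd ℂ (s : ℂ))⁻¹ = s := fun s => by
    rw [← Circle.coe_inv_eq_conj, ← Circle.coe_inv, inv_inv]
  -- Schwarz reflection: the conjugate of `g` at the reflected point `1 / conj z` is analytic near
  -- `t` and equals the conjugate of `g` on the circle. Unitarity becomes an analytic identity, to
  -- which the identity theorem applies.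
  have hka : ∀ i j, AnalyticAt ℂ
      (fun z => starRingEnd ℂ (g ((starRingEnd ℂ z)⁻¹) i j)) t := by
    intro i j
    have h1 : AnalyticAt ℂ (fun w : ℂ => g w⁻¹ i j) (starRingEnd ℂ (t : ℂ)) := by
      refine AnalyticAt.fun_comp (g := fun w => g w i j) (f := fun w : ℂ => w⁻¹) ?_
        (analyticAt_id.inv (by simp))
      rw [hconj]
      exact hga i j
    rw [Complex.analyticAt_iff_eventually_differentiableAt] at h1 ⊢
    have h2 := (Complex.continuous_conj.tendsto (t : ℂ)).eventually h1
    filter_upwards [h2] with z hz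
    have := hz.conj_conj
    rw [Complex.conj_conj] at this
    exact this
  have hp : ∀ i j, ∀ᶠ z in 𝓝 (t : ℂ),
      (∑ k, starRingEnd ℂ (g ((starRingEnd ℂ z)⁻¹) k i) * g z k j) - (1 : Matrix n n ℂ) i j = 0 := by
    intro i j
    have h1 : AnalyticAt ℂ (fun z => (∑ k, starRingEnd ℂ (g ((starRingEnd ℂ z)⁻¹) k i) * g z k j) -
        (1 : Matrix n n ℂ) i j) t :=
      (Finset.analyticAt_fun_sum _ fun k _ => (hka k i).mul (hga k j)).sub analyticAt_const
    refine h1.frequently_zero_iff_eventually_zero.1 ?_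
    refine (tendsto_coe_circle_punctured t).frequently (hfr.mono fun s hs => ?_)
    have h2 := congrFun (congrFun (Matrix.mem_unitaryGroup_iff'.1 hs) i) j
    rw [hconj, ← h2, Matrix.mul_apply]
    simp [Matrix.star_apply]
  have hp' : ∀ᶠ z in 𝓝 (t : ℂ), ∀ i j,
      (∑ k, starRingEnd ℂ (g ((starRingEnd ℂ z)⁻¹) k i) * g z k j) - (1 : Matrix n n ℂ) i j = 0 :=
    eventually_all.2 fun i => eventually_all.2 fun j => hp i j
  filter_upwards [((by fun_prop : Continuous fun s : Circle => (s : ℂ)).tendsto t).eventually hp']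
    with s hs
  rw [Matrix.mem_unitaryGroup_iff']
  ext i j
  rw [← sub_eq_zero, ← hs i j, hconj, Matrix.mul_apply]
  simp [Matrix.star_apply]

/-- A point near which the Schur function continues analytically with unitary values `f(s)` such
that `1 - s f(s)` is invertible is not in the support. -/
lemma notMem_supp_of_unitary (hμ : IsMatrixMeasure μ) (hμ_one : μ univ = 1)
    (hg : IsAnalyticContinuation (schur μ) U g) {s₀ : Circle} (hU : (s₀ : ℂ) ∈ U)
    (hs : ∀ᶠ s : Circle in 𝓝 s₀, g (s : ℂ) ∈ Matrix.unitaryGroup n ℂ ∧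
      IsUnit (1 - (s : ℂ) • g (s : ℂ))) : s₀ ∉ supp μ := by
  have hga : ∀ i j, AnalyticAt ℂ (fun z => g z i j) s₀ := fun i j => hg.2.2.1 i j s₀ hU
  -- The inverse Cayley transform continues `F` from the disk analytically to `s₀`.
  set A : ℂ → Matrix n n ℂ := fun z => (1 + z • g z) * (1 - z • g z)⁻¹ with hA
  have hWa : ∀ i j, AnalyticAt ℂ (fun z => (z • g z) i j) s₀ := fun i j =>
    analyticAt_id.mul (hga i j)
  have hAa : ∀ i j, AnalyticAt ℂ (fun z => A z i j) s₀ := analyticAt_mul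
    (fun i j => analyticAt_const.add (hWa i j))
    (analyticAt_inv (fun i j => analyticAt_const.sub (hWa i j)) hs.self_of_nhds.2)
  have hAmul : ∀ z, IsUnit (1 - z • g z) → A z * (1 - z • g z) = 1 + z • g z := fun z hz => by
    rw [hA, Matrix.mul_assoc, Matrix.nonsing_inv_mul _ ((Matrix.isUnit_iff_isUnit_det _).1 hz),
      Matrix.mul_one]
  have hAF : ∀ z : ℂ, ‖z‖ < 1 → A z = caratheodory μ z := fun z hz => by
    have hFu := isUnit_caratheodory_add_one hμ hz
    have hW := hg.smul_eq_cayley hμ hμ_one hz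
    have hu : IsUnit (1 - z • g z) := by
      rw [hW]
      exact isUnit_one_sub_cayley hFu
    refine hu.mul_right_cancel ?_
    rw [hAmul z hu, hW, mul_one_sub_cayley hFu]
  have hre : ∀ᶠ s : Circle in 𝓝 s₀, ∀ v, (quadForm v (A s)).re = 0 := by
    filter_upwards [hs] with s hs v
    have hWu : (s : ℂ) • g s ∈ Matrix.unitaryGroup n ℂ := by
      have h1 := Matrix.mem_unitaryGroup_iff.1 hs.1
      have h2 : (s : ℂ) * star (s : ℂ) = 1 := by
        have := Complex.mul_conj (s : ℂ)
        rw [Circle.normSq_coe] at this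
        simpa using this
      rw [Matrix.mem_unitaryGroup_iff, star_smul, Matrix.smul_mul, Matrix.mul_smul, h1, smul_smul,
        h2, one_smul]
    have h3 := add_conjTranspose_eq_zero_of_unitary hWu hs.2 (hAmul s hs.2)
    have h4 : quadForm v (A s)ᴴ = star (quadForm v (A s)) := by
      rw [quadForm_apply, quadForm_apply, Matrix.dotProduct_mulVec, ← Matrix.star_mulVec,
        Matrix.star_dotProduct]
    have h5 := congrArg (quadForm v) h3
    rw [map_add, h4, map_zero] at h5
    have h6 := congrArg Complex.re h5
    simp only [Complex.add_re, Complex.star_def, Complex.conj_re, Complex.zero_re] at h6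
    linarith
  have hV : ∀ v, ∃ V : Set Circle, IsOpen V ∧ s₀ ∈ V ∧ scalarMeasure hμ v V = 0 := by
    intro v
    have hq : AnalyticAt ℂ (fun z => quadForm v (A z)) s₀ := by
      simp only [quadForm_eq_sum]
      exact Finset.analyticAt_fun_sum _ fun i _ => Finset.analyticAt_fun_sum _ fun j _ =>
        analyticAt_const.mul (hAa i j)
    -- The real part of `v* A v` vanishes on the circle near `s₀`; comparing `z` with `z / |z|` by a
    -- Lipschitz bound gives at most `K (1 - |z|)` inside.
    obtain ⟨K, N, hN, hL⟩ := (hq.contDiffAt (n := 1)).exists_lipschitzOnWith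
    obtain ⟨δ₁, hδ₁, hN'⟩ := Metric.mem_nhds_iff.1 hN
    obtain ⟨δ₂, hδ₂, hre'⟩ := Metric.eventually_nhds_iff.1 hre
    -- The `1` excludes `z = 0`; the half is needed because `z / |z|` can be twice as far from `s₀`
    -- as `z`.
    refine exists_isOpen_measure_eq_zero _ s₀ (C := K) (δ := min 1 (min δ₁ δ₂ / 2))
      (by positivity) fun z hz hdist => ?_
    have hd1 : dist z s₀ < 1 := hdist.trans_le (min_le_left _ _)
    have hd2 : dist z s₀ < min δ₁ δ₂ / 2 := hdist.trans_le (min_le_right _ _)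
    have hmin1 := min_le_left δ₁ δ₂
    have hmin2 := min_le_right δ₁ δ₂
    have hz0 : z ≠ 0 := by
      rintro rfl
      rw [dist_zero_left, Circle.norm_coe] at hd1
      exact hd1.false
    have hnz : 0 < ‖z‖ := norm_pos_iff.2 hz0
    set s : Circle := ⟨z / ‖z‖, mem_sphere_zero_iff_norm.2 (by
      rw [norm_div, Complex.norm_real, norm_norm, div_self hnz.ne'])⟩
      with hsdef
    have hzs : dist z s = 1 - ‖z‖ := by
      have h1 : z - s = -((1 - ‖z‖ : ℝ) : ℂ) * s := by
        have h2 : (‖z‖ : ℂ) ≠ 0 := by exact_mod_cast hnz.ne'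
        change z - z / ‖z‖ = -((1 - ‖z‖ : ℝ) : ℂ) * (z / ‖z‖)
        push_cast
        field_simp
        ring
      rw [dist_eq_norm, h1, norm_mul, norm_neg, Circle.norm_coe, Complex.norm_real,
        Real.norm_of_nonneg (by linarith), mul_one]
    have hz1 : 1 - ‖z‖ ≤ dist z s₀ := by
      rw [dist_comm, dist_eq_norm]
      have := norm_sub_norm_le (s₀ : ℂ) z
      rwa [Circle.norm_coe] at this
    have hss : dist (s : ℂ) s₀ < min δ₁ δ₂ := by
      have := dist_triangle_left (s : ℂ) s₀ z
      linarith
    have hzN : z ∈ N := hN' (Metric.mem_ball.2 (by linarith [dist_nonneg (x := z) (y := s₀)]))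
    have hsN : (s : ℂ) ∈ N := hN' (Metric.mem_ball.2 (by linarith))
    have h1 := hL.dist_le_mul z hzN s hsN
    rw [hzs, dist_eq_norm] at h1
    have h2 := (Complex.re_le_norm _).trans h1
    rw [Complex.sub_re, hre' (y := s) (hss.trans_le hmin2) v, sub_zero, hAF z hz,
      (isNullNear_of_norm_lt_one hμ hz).quadForm_caratheodory] at h2
    exact h2
  choose V hVo hVm hV0 using hV
  intro hsupp
  -- The neighbourhood depends on `v`, but the finitely many polarization vectors determine `μ`.
  set W : Set Circle := ⋂ i : n, ⋂ j : n, ⋂ k : Fin 4, V (polarVec i j k) with hW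
  have hWo : IsOpen W := isOpen_iInter_of_finite fun i => isOpen_iInter_of_finite fun j =>
    isOpen_iInter_of_finite fun k => hVo _
  have hWm : s₀ ∈ W := by
    simp only [hW, mem_iInter]
    exact fun i j k => hVm _
  refine hsupp W hWo hWm ?_
  ext i j
  rw [apply_eq_polarization (μ W) i j]
  have h0 : ∀ k, quadForm (polarVec i j k) (μ W) = 0 := fun k => by
    have h1 : scalarMeasure hμ (polarVec i j k) W = 0 := measure_mono_null
      (fun s hs => mem_iInter.1 (mem_iInter.1 (mem_iInter.1 hs i) j) k) (hV0 _)
    rw [← scalarMeasure_real hμ _ hWo.measurableSet]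
    simp [Measure.real, h1]
  simp [h0]

/-- An arc accumulates at each of its points, so unitarity spreads to a full neighbourhood of `t` in
the circle, even at an endpoint. There `det (1 - z g(z))` vanishes at most at `t`, so all other
nearby points are off the support. -/
lemma notMem_derivedSet_of_isArc (hμ : IsMatrixMeasure μ) (hμ_one : μ univ = 1) {Γ : Set Circle}
    (hΓ : IsArc Γ) (h : HasUnitaryContinuation (schur μ) Γ) {t : Circle} (ht : t ∈ Γ) :
    t ∉ derivedSet (supp μ) := by
  obtain ⟨U, g, hg, hu⟩ := h
  have hga : ∀ i j, AnalyticAt ℂ (fun z => g z i j) t := fun i j => hg.2.2.1 i j t (hu t ht).1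
  have hacc := hΓ.1.isPreconnected.preperfect_of_nontrivial hΓ.2 t ht
  have hunit := eventually_mem_unitaryGroup hga
    ((accPt_iff_frequently_nhdsNE.1 hacc).mono fun s hs => (hu s hs).2)
  have hdeta : AnalyticAt ℂ (fun z => (1 - z • g z).det) t :=
    analyticAt_det fun i j => analyticAt_const.sub (analyticAt_id.mul (hga i j))
  have hdet : ∀ᶠ z in 𝓝[≠] (t : ℂ), (1 - z • g z).det ≠ 0 := by
    -- Identical vanishing near `t` would reach points of the disk, where `1 - W` is invertible.
    refine hdeta.eventually_eq_zero_or_eventually_ne_zero.resolve_left fun h0 => ?_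
    have h1 := ((tendsto_radial t).mono_right nhdsWithin_le_nhds).eventually h0
    obtain ⟨r, hr0, hr⟩ := (h1.and (eventually_norm_radial_lt t)).exists
    have h2 := isUnit_one_sub_cayley (isUnit_caratheodory_add_one hμ hr)
    rw [← hg.smul_eq_cayley hμ hμ_one hr] at h2
    exact ((Matrix.isUnit_iff_isUnit_det _).1 h2).ne_zero hr0
  have hUn : ∀ᶠ s : Circle in 𝓝 t, (s : ℂ) ∈ U :=
    ((by fun_prop : Continuous fun s : Circle => (s : ℂ)).tendsto t).eventually
      (hg.1.mem_nhds (hu t ht).1)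
  have hdet' : ∀ᶠ s : Circle in 𝓝 t, s ≠ t → (1 - (s : ℂ) • g s).det ≠ 0 :=
    eventually_nhdsWithin_iff.1 ((tendsto_coe_circle_punctured t).eventually hdet)
  have hall : ∀ᶠ s : Circle in 𝓝 t, ∀ᶠ w : Circle in 𝓝 s, (w : ℂ) ∈ U ∧
      g (w : ℂ) ∈ Matrix.unitaryGroup n ℂ ∧ (w ≠ t → (1 - (w : ℂ) • g w).det ≠ 0) :=
    eventually_eventually_nhds.2 (hUn.and (hunit.and hdet'))
  rw [mem_derivedSet, accPt_iff_frequently, not_frequently]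
  filter_upwards [hall] with s hs hst
  refine notMem_supp_of_unitary hμ hμ_one hg hs.self_of_nhds.1 ?_ hst.2
  have hne : ∀ᶠ w in 𝓝 s, w ≠ t := isOpen_ne.mem_nhds hst.1
  filter_upwards [hs, hne] with w hw hwt
  exact ⟨hw.2.1, (Matrix.isUnit_iff_isUnit_det _).2 (isUnit_iff_ne_zero.2 (hw.2.2 hwt))⟩

end MatrixSchur

end

theorem mainTheorem2 {n : Type*} [Fintype n] [DecidableEq n]
    (μ : MeasureTheory.VectorMeasure Circle (Matrix n n ℂ))
    (hμ : MatrixSchur.IsMatrixMeasure μ) (hμ_one : μ Set.univ = 1) :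
    -- (i) the complement of the limit points of the support is the union of the arcs through which
    -- the Schur function continues analytically with unitary values
    (derivedSet (MatrixSchur.supp μ))ᶜ =
        ⋃₀ {Γ : Set Circle | MatrixSchur.IsArc Γ ∧
          MatrixSchur.HasUnitaryContinuation (MatrixSchur.schur μ) Γ} ∧
    -- and there is a single such continuation through the whole complement
    MatrixSchur.HasUnitaryContinuation (MatrixSchur.schur μ)
      (derivedSet (MatrixSchur.supp μ))ᶜ ∧
    -- (ii) here `g` is the analytically continued Schur function
    ∀ (U : Set ℂ) (g : ℂ → Matrix n n ℂ),
      MatrixSchur.IsAnalyticContinuation (MatrixSchur.schur μ) U g →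
      (∀ t ∈ (derivedSet (MatrixSchur.supp μ))ᶜ, (t : ℂ) ∈ U) →
      (∀ t : Circle, MatrixSchur.IsIsolatedMassPoint μ t ↔
        t ∈ (derivedSet (MatrixSchur.supp μ))ᶜ ∧ (1 - (t : ℂ) • g (t : ℂ)).det = 0) ∧
      (∀ t : Circle, MatrixSchur.IsIsolatedMassPoint μ t →
        LinearMap.range (μ {t}).mulVecLin =
          LinearMap.ker (1 - (t : ℂ) • g (t : ℂ)).mulVecLin) := by
  have hS := MatrixSchur.hasUnitaryContinuation_compl_derivedSet hμ hμ_one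
  refine ⟨Set.Subset.antisymm (fun t ht => ?_) ?_, hS, fun U g hg hU => ⟨fun t => ?_, fun t ht => ?_⟩⟩
  · obtain ⟨Γ, hΓS, hΓ, htΓ⟩ := MatrixSchur.exists_isArc_subset
      (isClosed_derivedSet (MatrixSchur.supp μ)).isOpen_compl ht
    obtain ⟨U, g, hg, hu⟩ := hS
    exact ⟨Γ, ⟨hΓ, U, g, hg, fun s hs => hu s (hΓS hs)⟩, htΓ⟩
  · rintro t ⟨Γ, ⟨hΓ, h⟩, ht⟩
    exact MatrixSchur.notMem_derivedSet_of_isArc hμ hμ_one hΓ h ht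
  · rw [MatrixSchur.isIsolatedMassPoint_iff hμ]
    refine and_congr_right fun ht => ?_
    rw [Ne, MatrixSchur.apply_singleton_eq_zero_iff hμ hμ_one hg (hU t ht), not_not]
  · exact MatrixSchur.range_eq_ker hμ hμ_one hg
      (hU t ((MatrixSchur.isIsolatedMassPoint_iff hμ t).1 ht).1)
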